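/- Let $\mathbb K=\mathbb C((\hbar))$, and let $\mathbb W_{2n}$ be the Weyl algebra of $\mathbb R^{2n}$ with its standard symplectic form $\omega=\sum_{i=1}^n dp_i\wedge dq_i$: the $\mathbb K$-vector space of polynomials $\mathbb K[p_1,\dots,p_n,q_1,\dots,q_n]$ with the Moyal product $a\star b=m(\exp(\hbar\alpha)(a\otimes b))$, where $m$ is the commutative product of polynomials and $\alpha(a\otimes b)=\sum_{i=1}^n\bigl(\frac{\partial a}{\partial p_i}\otimes\frac{\partial b}{\partial q_i}-\frac{\partial a}{\partial q_i}\otimes\frac{\partial b}{\partial p_i}\bigr)$. A linear symplectomorphism $\gamma$ of $\mathbb R^{2n}$ acts on $\mathbb W_{2n}$ by the algebra automorphism $f\mapsto f\circ\gamma^{-1}$, again denoted $\gamma$. For a $\mathbb K$-algebra $A$ with an automorphism $\gamma$, let $HH^\gamma_\bullet(A)=H_\bullet(A,A_\gamma)$ be the Hochschild homology over $\mathbb K$ of $A$ with coefficients in the bimodule $A_\gamma$, which is $A$ with $a_1\cdot a\cdot a_2=a_1\,a\,\gamma(a_2)$. **Proposition.** Let $\gamma$ be a linear symplectomorphism of $\mathbb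 R^{2n}$ whose fixed point space has dimension $2k$. Then, as $\mathbb K$-vector spaces, $$HH^\gamma_p(\mathbb W_{2n})\cong\begin{cases}\mathbb K & \text{if } p=2k,\\ 0 & \text{if } p\neq 2k.\end{cases}$$ -/

import Mathlib

open scoped TensorProduct


namespace Hochschild

universe u

variable (K : Type u) [CommRing K] {A : Type u} [Ring A] [Algebra K A]

/-- Let `A_γ` be the `A`-bimodule with underlying space `A` and `a₁ · a · a₂ = a₁ * a * γ a₂`.
This is the `i`-th face of the standard (Hochschild) complex of `A` with coefficients in `A_γ`, on
tuples `(a₀, …, a_{p+1})`, where `a₀` is in `A_γ` and `a₁, …, a_{p+1}` are in `A`: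
* `i = 0`: `(a₀ * γ a₁, a₂, …, a_{p+1})`, i.e. `(a₀ · a₁, a₂, …)`;
* `0 < i < p + 1`: `(a₀, …, a_i * a_{i+1}, …, a_{p+1})`;
* `i = p + 1`: `(a_{p+1} * a₀, a₁, …, a_p)`, i.e. `(a_{p+1} · a₀, a₁, …)`. -/
def face (γ : A ≃ₐ[K] A) {p : ℕ} (i : Fin (p + 2)) (a : Fin (p + 2) → A) : Fin (p + 1) → A :=
  fun j =>
    if i = Fin.last (p + 1) then
      if j = 0 then a (Fin.last (p + 1)) * a 0 else a j.castSucc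
    else if i = 0 then
      if j = 0 then a 0 * γ (a 1) else a j.succ
    else Fin.contractNth i (fun x y => x * y) a j

theorem face_update (γ : A ≃ₐ[K] A) {p : ℕ} (i m : Fin (p + 2)) (a : Fin (p + 2) → A) :
    ∃ (l : Fin (p + 1)) (L : A →ₗ[K] A), ∀ x,
      face K γ i (Function.update a m x) = Function.update (face K γ i a) l (L x) := by
  by_cases h1 : i = Fin.last (p + 1)
  · subst h1
    by_cases hm : m = Fin.last (p + 1)
    · subst hm
      refine ⟨0, LinearMap.mulRight K (a 0), fun x => funext fun j => ?_⟩
      by_cases hj : j = 0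
      · subst hj
        simp [face, Fin.ext_iff]
      · simp [face, hj, Fin.castSucc_ne_last]
    · by_cases hm0 : m = 0
      · subst hm0
        refine ⟨0, LinearMap.mulLeft K (a (Fin.last _)), fun x => funext fun j => ?_⟩
        by_cases hj : j = 0
        · subst hj
          simp [face, Fin.ext_iff]
        · simp [face, hj] 
      · have : (m : ℕ) < p + 1 := Fin.val_lt_last hm
        have h0 : (m : ℕ) ≠ 0 := fun h => hm0 (Fin.ext h)
        refine ⟨⟨m, this⟩, LinearMap.id, fun x => funext fun j => ?_⟩
        simp only [face, Function.update_apply, Fin.ext_iff, Fin.val_last, Fin.val_zero, Fin.val_castSucc, LinearMap.id_apply]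
        grind
  · have hi : (i : ℕ) < p + 1 := Fin.val_lt_last h1
    by_cases h0 : i = 0
    · subst h0
      by_cases hm0 : m = 0
      · subst hm0
        refine ⟨0, LinearMap.mulRight K (γ (a 1)), fun x => funext fun j => ?_⟩
        by_cases hj : j = 0
        · subst hj
          simp [face, Fin.ext_iff]
        · simp [face, hj, Fin.ext_iff]
      · by_cases hm1 : m = 1
        · subst hm1
          refine ⟨0, LinearMap.mulLeft K (a 0) ∘ₗ γ.toLinearMap, fun x => funext fun j => ?_⟩
          by_cases hj : j = 0
          · subst hj
            simp [face, Fin.ext_iff]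
          · simp [face, hj, Fin.ext_iff] 
        · have q0 : (m : ℕ) ≠ 0 := fun h => hm0 (Fin.ext h)
          have q1 : (m : ℕ) ≠ 1 := fun h => hm1 (Fin.ext (by simpa using h))
          refine ⟨⟨m - 1, by omega⟩, LinearMap.id, fun x => funext fun j => ?_⟩
          simp only [face, Function.update_apply, Fin.ext_iff, Fin.val_last, Fin.val_zero, Fin.val_succ, LinearMap.id_apply, Fin.val_one]
          grind
    · by_cases c1 : m = i
      · subst c1
        refine ⟨⟨m, hi⟩, LinearMap.mulRight K (a ⟨m + 1, by omega⟩), fun x => funext fun j => ?_⟩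
        simp only [face, h1, h0, if_false, Fin.contractNth, Function.update_apply, Fin.ext_iff, Fin.val_castSucc, Fin.val_succ, LinearMap.mulRight_apply]
        have e (hj : (j : ℕ) = m) : j.succ = ⟨m + 1, by omega⟩ := Fin.ext (by simp [hj])
        grind
      · by_cases c2 : (m : ℕ) = i + 1
        · refine ⟨⟨i, hi⟩, LinearMap.mulLeft K (a i), fun x => funext fun j => ?_⟩
          simp only [face, h1, h0, if_false, Fin.contractNth, Function.update_apply, Fin.ext_iff, Fin.val_castSucc, Fin.val_succ, LinearMap.mulLeft_apply]
          have e (hj : (j : ℕ) = i) : j.castSucc = i := Fin.ext (by simp [hj])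
          grind
        · have c1' : (m : ℕ) ≠ i := fun h => c1 (Fin.ext h)
          refine ⟨⟨if (m : ℕ) < i then m else m - 1, by split_ifs <;> omega⟩, LinearMap.id, fun x => funext fun j => ?_⟩
          simp only [face, h1, h0, if_false, Fin.contractNth, Function.update_apply, Fin.ext_iff, Fin.val_castSucc, Fin.val_succ, LinearMap.id_apply]
          grind


/-- The faces on sequences indexed by `ℕ` (auxiliary, for index computations only). -/
def natFace (γ : A ≃ₐ[K] A) (p i : ℕ) (b : ℕ → A) (t : ℕ) : A :=
  if i = p + 1 then (if t = 0 then b (p + 1) * b 0 else b t)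
  else if i = 0 then (if t = 0 then b 0 * γ (b 1) else b (t + 1))
  else if t < i then b t else if t = i then b t * b (t + 1) else b (t + 1)

theorem face_nat (γ : A ≃ₐ[K] A) {p : ℕ} (i : Fin (p + 2)) (b : ℕ → A) :
    face K γ i (fun t : Fin (p + 2) => b t) =
      fun t : Fin (p + 1) => natFace K γ p i b t := by
  ext t
  simp only [face, natFace, Fin.contractNth, Fin.ext_iff, Fin.val_last, Fin.val_zero,
    Fin.val_castSucc, Fin.val_succ, Fin.val_one]

theorem face_face (γ : A ≃ₐ[K] A) {p : ℕ} (i : Fin (p + 2)) (j : Fin (p + 3))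
    (hij : (j : ℕ) ≤ i) (a : Fin (p + 3) → A) :
    face K γ i (face K γ j a) =
      face K γ (j.castLT (lt_of_le_of_lt hij i.2)) (face K γ i.succ a) := by
  obtain ⟨b, rfl⟩ : ∃ b : ℕ → A, a = fun t : Fin (p + 3) => b t :=
    ⟨fun t => if h : t < p + 3 then a ⟨t, h⟩ else 0, by ext t; simp⟩
  rw [face_nat, face_nat, face_nat, face_nat]
  ext t
  obtain ⟨i, hi⟩ := i
  obtain ⟨j, hj⟩ := j
  obtain ⟨t, ht⟩ := t
  have hij' : j ≤ i := hij
  simp only [Fin.val_succ, Fin.val_castLT, natFace]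
  have hj2 : j ≠ p + 2 := by omega
  have hi2 : i + 1 ≠ 0 := by omega
  simp only [hj2, hi2, if_false]
  by_cases h1 : i = p + 1
  · subst h1
    simp only [if_true]
    by_cases h0 : j = 0
    · subst h0
      by_cases ht0 : t = 0
      · subst ht0; simp [mul_assoc]
      · simp [ht0]
    · by_cases h3 : j = p + 1
      · subst h3
        by_cases ht0 : t = 0
        · subst ht0; simp [mul_assoc]
        · have : t < p + 1 := by omega
          simp [ht0, this]
      · simp only [h0, h3, if_false]
        by_cases ht0 : t = 0
        · subst ht0
          have a1 : ¬ (p + 1 < j) := by omega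
          have a2 : ¬ (p + 1 = j) := by omega
          have a3 : 0 < j := by omega
          simp [a1, a2, a3]
        · have a3 : 0 < j := by omega
          simp [ht0]
  · have h2 : j ≠ p + 1 := by omega
    have h3 : i + 1 ≠ p + 2 := by omega
    simp only [h1, h2, h3, if_false]
    by_cases h0 : j = 0
    · subst h0
      by_cases hi0 : i = 0
      · subst hi0
        by_cases ht0 : t = 0
        · subst ht0; simp [mul_assoc]
        · simp [ht0]
      · by_cases ht0 : t = 0
        · subst ht0
          have : 0 < i := by omega
          simp [hi0, this]
        · simp [hi0, ht0]
    · have : i ≠ 0 := by omega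
      simp only [h0, this, if_false]
      rcases lt_trichotomy t j with h | h | h <;> rcases lt_trichotomy t i with h' | h' | h' <;>
        first | omega | grind [mul_assoc]


/-- The `i`-th face as a linear map on the twisted Hochschild chains. -/
noncomputable def faceMap (γ : A ≃ₐ[K] A) (p : ℕ) (i : Fin (p + 2)) :
    (⨂[K] _ : Fin (p + 2), A) →ₗ[K] ⨂[K] _ : Fin (p + 1), A :=
  PiTensorProduct.lift <| MultilinearMap.mk'
    (fun a : Fin (p + 2) → A => PiTensorProduct.tprod K (face K γ i a))
    (fun a m x y => by
      obtain ⟨l, L, h⟩ := face_update K γ i m a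
      simp only [h, map_add, MultilinearMap.map_update_add])
    (fun a m c x => by
      obtain ⟨l, L, h⟩ := face_update K γ i m a
      simp only [h, map_smul, MultilinearMap.map_update_smul])

theorem faceMap_tprod (γ : A ≃ₐ[K] A) (p : ℕ) (i : Fin (p + 2)) (a : Fin (p + 2) → A) :
    faceMap K γ p i (PiTensorProduct.tprod K a) = PiTensorProduct.tprod K (face K γ i a) := by
  simp [faceMap]

/-- The Hochschild boundary `b = ∑ᵢ (-1)ⁱ dᵢ : A_γ ⊗ A^{⊗(p+1)} → A_γ ⊗ A^{⊗p}`, all tensor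
products being over `K`. -/
noncomputable def boundary (γ : A ≃ₐ[K] A) (p : ℕ) :
    (⨂[K] _ : Fin (p + 2), A) →ₗ[K] ⨂[K] _ : Fin (p + 1), A :=
  ∑ i : Fin (p + 2), (-1 : K) ^ (i : ℕ) • faceMap K γ p i

theorem sum_comp_sum {M N P : Type*} [AddCommGroup M] [AddCommGroup N] [AddCommGroup P]
    [Module K M] [Module K N] [Module K P] {m n : ℕ} (c : Fin m → K) (d : Fin n → K)
    (f : Fin m → N →ₗ[K] P) (g : Fin n → M →ₗ[K] N) :
    (∑ i, c i • f i) ∘ₗ (∑ j, d j • g j) =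
      ∑ x : Fin m × Fin n, (c x.1 * d x.2) • (f x.1 ∘ₗ g x.2) := by
  rw [Fintype.sum_prod_type]
  refine LinearMap.ext fun v => ?_
  simp only [LinearMap.comp_apply, LinearMap.sum_apply, map_sum, map_smul, mul_smul,
    LinearMap.smul_apply, Finset.smul_sum]
  rw [Finset.sum_comm]
  refine Finset.sum_congr rfl fun i _ => Finset.sum_congr rfl fun j _ => smul_comm _ _ _

theorem boundary_boundary (γ : A ≃ₐ[K] A) (p : ℕ) :
    boundary K γ p ∘ₗ boundary K γ (p + 1) = 0 := by
  have hf : ∀ (i : Fin (p + 2)) (j : Fin (p + 3)) (hij : (j : ℕ) ≤ i),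
      faceMap K γ p i ∘ₗ faceMap K γ (p + 1) j =
        faceMap K γ p (j.castLT (lt_of_le_of_lt hij i.2)) ∘ₗ faceMap K γ (p + 1) i.succ := by
    intro i j hij
    ext a
    simp [faceMap_tprod, face_face K γ i j hij]
  have hsum : boundary K γ p ∘ₗ boundary K γ (p + 1) =
      ∑ x : Fin (p + 2) × Fin (p + 3), (-1 : K) ^ ((x.1 : ℕ) + (x.2 : ℕ)) •
        (faceMap K γ p x.1 ∘ₗ faceMap K γ (p + 1) x.2) := by
    simp only [boundary, sum_comp_sum, pow_add]
  let S : Finset (Fin (p + 2) × Fin (p + 3)) := {x | (x.2 : ℕ) ≤ (x.1 : ℕ)}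
  rw [hsum, ← Finset.sum_add_sum_compl S, ← eq_neg_iff_add_eq_zero, ← Finset.sum_neg_distrib]
  have hS : ∀ x : Fin (p + 2) × Fin (p + 3), x ∈ S ↔ (x.2 : ℕ) ≤ (x.1 : ℕ) := by simp [S]
  refine Finset.sum_bij (fun x hx =>
    (x.2.castLT (lt_of_le_of_lt ((hS x).1 hx) x.1.2), x.1.succ)) ?_ ?_ ?_ ?_
  · intro x hx
    have := (hS x).1 hx
    simp only [Finset.mem_compl, hS, Fin.val_succ, Fin.val_castLT]
    omega
  · rintro ⟨i, j⟩ _ ⟨i', j'⟩ _ h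
    simp only [Prod.mk.injEq, Fin.ext_iff, Fin.val_castLT, Fin.val_succ] at h ⊢
    omega
  · rintro ⟨i, j⟩ h
    simp only [Finset.mem_compl, hS, not_le] at h
    have hj : j ≠ 0 := by rintro rfl; simp at h
    have hj' : (j.pred hj : ℕ) = j - 1 := Fin.val_pred j hj
    refine ⟨(j.pred hj, i.castSucc), ?_, ?_⟩
    · simp only [hS, Fin.val_castSucc]
      omega
    · simp
  · rintro ⟨i, j⟩ h
    simp only [hf i j ((hS _).1 h), Fin.val_castLT, Fin.val_succ]
    have e : (-1 : K) ^ ((i : ℕ) + (j : ℕ)) = -(-1 : K) ^ ((j : ℕ) + ((i : ℕ) + 1)) := by ring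
    rw [e]
    exact neg_smul ((-1 : K) ^ ((j : ℕ) + ((i : ℕ) + 1))) (faceMap K γ p (j.castLT _) ∘ₗ faceMap K γ (p + 1) i.succ)

/-- The standard chain complex computing the Hochschild homology of the `K`-algebra `A` with
coefficients in the bimodule `A_γ`; it is `A_γ ⊗ A^{⊗p} = A^{⊗(p+1)}` in degree `p`. -/
noncomputable def twistedComplex (γ : A ≃ₐ[K] A) : ChainComplex (ModuleCat.{u} K) ℕ :=
  ChainComplex.of (fun p => ModuleCat.of K (⨂[K] _ : Fin (p + 1), A))
    (fun p => ModuleCat.ofHom (boundary K γ p))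
    (fun p => by rw [← ModuleCat.ofHom_comp, boundary_boundary]; rfl)

/-- The twisted Hochschild homology `HH_p^γ(A) = H_p(A, A_γ)`, a `K`-module. -/
noncomputable abbrev HH (γ : A ≃ₐ[K] A) (p : ℕ) : ModuleCat.{u} K :=
  (twistedComplex K γ).homology p

end Hochschild

namespace LocNil
variable {K M N : Type*} [Field K] [AddCommGroup M] [Module K M] [AddCommGroup N] [Module K N]

/-- Locally nilpotent endomorphisms. -/
def IsLocNil (f : Module.End K M) : Prop := ∀ x, ∃ r : ℕ, (f ^ r) x = 0

/-- The exponential `exp(f) x = ∑ᵣ fʳ(x) / r!`; for locally nilpotent `f` (the only case in which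
it is used) all but finitely many terms of the sum vanish. -/
noncomputable def lexp (f : Module.End K M) (x : M) : M :=
  ∑ᶠ r : ℕ, ((r.factorial : K)⁻¹) • (f ^ r) x

theorem pow_zero_of_le {f : Module.End K M} {x : M} {r s : ℕ} (h : (f ^ r) x = 0) (hs : r ≤ s) :
    (f ^ s) x = 0 := by
  obtain ⟨t, rfl⟩ := Nat.exists_eq_add_of_le' hs
  rw [pow_add, Module.End.mul_apply, h, map_zero]

theorem lexp_eq_sum {f : Module.End K M} {x : M} {r : ℕ} (h : (f ^ r) x = 0) :
    lexp f x = ∑ i ∈ Finset.range r, ((i.factorial : K)⁻¹) • (f ^ i) x := by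
  refine finsum_eq_sum_of_support_subset _ fun i hi => ?_
  by_contra hn
  simp only [Finset.coe_range, Set.mem_Iio, not_lt] at hn
  exact hi (by simp [pow_zero_of_le h hn])

theorem lexp_zero_of {f : Module.End K M} {x : M} (h : f x = 0) : lexp f x = x := by
  rw [lexp_eq_sum (r := 1) (by simpa using h)]
  simp

theorem lexp_map {f : Module.End K M} {g : Module.End K N} (u : M →ₗ[K] N) (hf : IsLocNil f)
    (h : u ∘ₗ f = g ∘ₗ u) (x : M) : lexp g (u x) = u (lexp f x) := by
  have hp : ∀ (r : ℕ) (y : M), (g ^ r) (u y) = u ((f ^ r) y) := by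
    intro r
    induction r with
    | zero => intro y; simp
    | succ r ih =>
      intro y
      have := LinearMap.congr_fun h y
      simp only [LinearMap.comp_apply] at this
      rw [pow_succ, pow_succ, Module.End.mul_apply, Module.End.mul_apply, ← this, ih]
  obtain ⟨r, hr⟩ := hf x
  rw [lexp_eq_sum hr, lexp_eq_sum (r := r) (by rw [hp, hr, map_zero])]
  simp [hp]

theorem lexp_add {f : Module.End K M} (hf : IsLocNil f) (x y : M) :
    lexp f (x + y) = lexp f x + lexp f y := by
  obtain ⟨r, hr⟩ := hf x
  obtain ⟨s, hs⟩ := hf y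
  have h1 := pow_zero_of_le hr (le_max_left r s)
  have h2 := pow_zero_of_le hs (le_max_right r s)
  rw [lexp_eq_sum h1, lexp_eq_sum h2, lexp_eq_sum (r := max r s) (by rw [map_add, h1, h2, add_zero])]
  simp [Finset.sum_add_distrib]

theorem lexp_smul {f : Module.End K M} (hf : IsLocNil f) (c : K) (x : M) :
    lexp f (c • x) = c • lexp f x :=
  lexp_map (c • LinearMap.id) hf (by ext; simp) x

theorem pow_apply_comm {f g : Module.End K M} (h : Commute f g) (i j : ℕ) (x : M) :
    (f ^ i) ((g ^ j) x) = (g ^ j) ((f ^ i) x) :=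
  LinearMap.congr_fun (h.pow_pow i j) x

theorem add_pow_apply {f g : Module.End K M} (h : Commute f g) (r : ℕ) (x : M) :
    ((f + g) ^ r) x = ∑ ij ∈ Finset.HasAntidiagonal.antidiagonal r, (r.choose ij.1) • (f ^ ij.1) ((g ^ ij.2) x) := by
  rw [h.add_pow']
  simp

theorem IsLocNil.add_aux {f g : Module.End K M} (h : Commute f g) {x : M} {r s : ℕ}
    (hf : (f ^ r) x = 0) (hg : (g ^ s) x = 0) {i j : ℕ} (hij : r + s ≤ i + j) :
    (f ^ i) ((g ^ j) x) = 0 := by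
  by_cases hj : s ≤ j
  · rw [pow_zero_of_le hg hj, map_zero]
  · rw [pow_apply_comm h, pow_zero_of_le hf (by omega), map_zero]

theorem IsLocNil.add {f g : Module.End K M} (hf : IsLocNil f) (hg : IsLocNil g)
    (h : Commute f g) : IsLocNil (f + g) := by
  intro x
  obtain ⟨r, hr⟩ := hf x
  obtain ⟨s, hs⟩ := hg x
  refine ⟨r + s, ?_⟩
  rw [add_pow_apply h]
  refine Finset.sum_eq_zero fun ij hij => ?_
  rw [IsLocNil.add_aux h hr hs (by rw [Finset.HasAntidiagonal.mem_antidiagonal.1 hij]), smul_zero]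

theorem IsLocNil.smul {f : Module.End K M} (hf : IsLocNil f) (c : K) : IsLocNil (c • f) := by
  intro x
  obtain ⟨r, hr⟩ := hf x
  exact ⟨r, by simp [smul_pow, hr]⟩

theorem IsLocNil.zero : IsLocNil (0 : Module.End K M) := fun x => ⟨1, by simp⟩

theorem IsLocNil.sub {f g : Module.End K M} (hf : IsLocNil f) (hg : IsLocNil g)
    (h : Commute f g) : IsLocNil (f - g) := by
  have := hf.add (hg.smul (-1)) (h.smul_right (-1))
  simpa [sub_eq_add_neg] using this

theorem IsLocNil.sum {ι : Type*} (s : Finset ι) (f : ι → Module.End K M)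
    (hf : ∀ i, IsLocNil (f i)) (h : ∀ i j, Commute (f i) (f j)) : IsLocNil (∑ i ∈ s, f i) := by
  classical
  induction s using Finset.induction_on with
  | empty => simpa using IsLocNil.zero
  | insert a s ha ih =>
    rw [Finset.sum_insert ha]
    exact (hf a).add ih (Commute.sum_right _ _ _ fun j _ => h a j)

theorem lexp_add_comm [CharZero K] {f g : Module.End K M} (hf : IsLocNil f) (hg : IsLocNil g)
    (h : Commute f g) (x : M) : lexp (f + g) x = lexp f (lexp g x) := by
  obtain ⟨r, hr⟩ := hf x
  obtain ⟨s, hs⟩ := hg x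
  set L := r + s with hL
  have hz : ∀ i j : ℕ, L ≤ i + j → (f ^ i) ((g ^ j) x) = 0 :=
    fun i j hij => IsLocNil.add_aux h hr hs hij
  have hR : lexp f (lexp g x) = ∑ ij ∈ Finset.range L ×ˢ Finset.range L,
      (((ij.1.factorial : K)⁻¹) * ((ij.2.factorial : K)⁻¹)) • (f ^ ij.1) ((g ^ ij.2) x) := by
    rw [lexp_eq_sum (x := x) (pow_zero_of_le hs (by omega : s ≤ L)), Finset.sum_product]
    rw [lexp_eq_sum (r := L)]
    · refine Finset.sum_congr rfl fun i _ => ?_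
      rw [map_sum, Finset.smul_sum]
      refine Finset.sum_congr rfl fun j _ => ?_
      rw [map_smul, smul_smul]
    · rw [map_sum]
      refine Finset.sum_eq_zero fun j _ => ?_
      rw [map_smul, hz L j (by omega), smul_zero]
  have hLx : ((f + g) ^ L) x = 0 := by
    rw [add_pow_apply h]
    refine Finset.sum_eq_zero fun ij hij => ?_
    rw [hz _ _ (by rw [Finset.HasAntidiagonal.mem_antidiagonal.1 hij]), smul_zero]
  rw [hR, lexp_eq_sum hLx]
  have hl : ∀ k ∈ Finset.range L, ((k.factorial : K)⁻¹) • ((f + g) ^ k) x =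
      ∑ ij ∈ Finset.HasAntidiagonal.antidiagonal k,
        (((ij.1.factorial : K)⁻¹) * ((ij.2.factorial : K)⁻¹)) • (f ^ ij.1) ((g ^ ij.2) x) := by
    intro k _
    rw [add_pow_apply h, Finset.smul_sum]
    refine Finset.sum_congr rfl fun ij hij => ?_
    have hk := Finset.HasAntidiagonal.mem_antidiagonal.1 hij
    rw [← Nat.cast_smul_eq_nsmul K, smul_smul]
    congr 1
    have h1 := Nat.choose_mul_factorial_mul_factorial (n := k) (k := ij.1) (by omega)
    have h2 : k - ij.1 = ij.2 := by omega
    rw [h2] at h1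
    have h3 : ((k.choose ij.1 : ℕ) : K) * (ij.1.factorial : K) * (ij.2.factorial : K) =
      (k.factorial : K) := by exact_mod_cast h1
    have a1 : (ij.1.factorial : K) ≠ 0 := Nat.cast_ne_zero.2 (Nat.factorial_ne_zero _)
    have a2 : (ij.2.factorial : K) ≠ 0 := Nat.cast_ne_zero.2 (Nat.factorial_ne_zero _)
    have a3 : (k.factorial : K) ≠ 0 := Nat.cast_ne_zero.2 (Nat.factorial_ne_zero _)
    field_simp
    linear_combination h3
  rw [Finset.sum_congr rfl hl, Finset.sum_sigma']
  refine Finset.sum_bij_ne_zero (fun x _ _ => x.2) ?_ ?_ ?_ ?_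
  · rintro ⟨k, i, j⟩ h1 _
    simp only [Finset.mem_sigma, Finset.mem_range, Finset.HasAntidiagonal.mem_antidiagonal] at h1
    simp only [Finset.mem_product, Finset.mem_range]
    omega
  · rintro ⟨k, i, j⟩ h1 _ ⟨k', i', j'⟩ h2 _ h3
    simp only [Finset.mem_sigma, Finset.mem_range, Finset.HasAntidiagonal.mem_antidiagonal] at h1 h2
    simp only [Prod.mk.injEq] at h3
    obtain ⟨rfl, rfl⟩ := h3
    obtain rfl : k = k' := by omega
    rfl
  · rintro ⟨i, j⟩ _ h2
    have : i + j < L := by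
      by_contra hn
      exact h2 (by simp [hz i j (by omega)])
    exact ⟨⟨i + j, i, j⟩, by simpa using this, h2, rfl⟩
  · intros; rfl

theorem IsLocNil.map_right {f : Module.End K M} {g : Module.End K N} (hg : IsLocNil g) :
    IsLocNil (TensorProduct.map f g : Module.End K (M ⊗[K] N)) := by
  intro x
  induction x with
  | zero => exact ⟨0, by simp⟩
  | tmul a b =>
    obtain ⟨r, hr⟩ := hg b
    exact ⟨r, by rw [TensorProduct.map_pow, TensorProduct.map_tmul, hr, TensorProduct.tmul_zero]⟩
  | add a b ha hb =>
    obtain ⟨r, hr⟩ := ha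
    obtain ⟨s, hs⟩ := hb
    exact ⟨max r s, by rw [map_add, pow_zero_of_le hr (le_max_left r s),
      pow_zero_of_le hs (le_max_right r s), add_zero]⟩

theorem IsLocNil.map_left {f : Module.End K M} {g : Module.End K N} (hf : IsLocNil f) :
    IsLocNil (TensorProduct.map f g : Module.End K (M ⊗[K] N)) := by
  intro x
  induction x with
  | zero => exact ⟨0, by simp⟩
  | tmul a b =>
    obtain ⟨r, hr⟩ := hf a
    exact ⟨r, by rw [TensorProduct.map_pow, TensorProduct.map_tmul, hr, TensorProduct.zero_tmul]⟩
  | add a b ha hb =>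
    obtain ⟨r, hr⟩ := ha
    obtain ⟨s, hs⟩ := hb
    exact ⟨max r s, by rw [map_add, pow_zero_of_le hr (le_max_left r s),
      pow_zero_of_le hs (le_max_right r s), add_zero]⟩

theorem commute_map {f f' : Module.End K M} {g g' : Module.End K N} (hf : Commute f f')
    (hg : Commute g g') :
    Commute (TensorProduct.map f g : Module.End K (M ⊗[K] N)) (TensorProduct.map f' g') := by
  change _ * _ = _ * _
  rw [← TensorProduct.map_mul, ← TensorProduct.map_mul, hf.eq, hg.eq]

end LocNil

namespace Weyl
open LocNil MvPolynomial

noncomputable section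

variable (K : Type) [Field K]

/-- The polynomials `K[p₁, …, pₙ, q₁, …, qₙ]`; `pᵢ` is `X (Sum.inl i)`, `qᵢ` is `X (Sum.inr i)`. -/
abbrev Poly (n : ℕ) : Type := MvPolynomial (Fin n ⊕ Fin n) K

/-- `∂/∂pᵢ` (for `Sum.inl i`) and `∂/∂qᵢ` (for `Sum.inr i`) -/
def partialD (n : ℕ) (s : Fin n ⊕ Fin n) : Module.End K (Poly K n) := (pderiv s).toLinearMap

/-- The Poisson tensor acting on the tensor square of the polynomials,
`α (a ⊗ b) = ∑ᵢ (∂a/∂pᵢ ⊗ ∂b/∂qᵢ - ∂a/∂qᵢ ⊗ ∂b/∂pᵢ)`. -/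
def poisson (n : ℕ) : Module.End K (Poly K n ⊗[K] Poly K n) :=
  ∑ i : Fin n,
    (TensorProduct.map (partialD K n (Sum.inl i)) (partialD K n (Sum.inr i)) -
      TensorProduct.map (partialD K n (Sum.inr i)) (partialD K n (Sum.inl i)))

/-- The Moyal product `a ⋆ b = m (exp (h α) (a ⊗ b))`, with `m` the commutative product. -/
def moyal {K : Type} [Field K] (h : K) (n : ℕ) (a b : Poly K n) : Poly K n :=
  LinearMap.mul' K (Poly K n) (lexp (h • poisson K n) (a ⊗ₜ[K] b))

section General
variable {K} {n : ℕ} {M N M' N' : Type} [AddCommGroup M] [Module K M] [AddCommGroup N] [Module K N]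
  [AddCommGroup M'] [Module K M'] [AddCommGroup N'] [Module K N']

/-- `∑ᵢ (D(pᵢ) ⊗ E(qᵢ) - D(qᵢ) ⊗ E(pᵢ))` for families of operators `D`, `E`
(auxiliary, for the proof of associativity). -/
def bi (D : Fin n ⊕ Fin n → Module.End K M) (E : Fin n ⊕ Fin n → Module.End K N) :
    Module.End K (M ⊗[K] N) :=
  ∑ i : Fin n, (TensorProduct.map (D (Sum.inl i)) (E (Sum.inr i)) -
      TensorProduct.map (D (Sum.inr i)) (E (Sum.inl i)))

theorem bi_tmul (D : Fin n ⊕ Fin n → Module.End K M) (E : Fin n ⊕ Fin n → Module.End K N)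
    (x : M) (y : N) : bi D E (x ⊗ₜ[K] y) = ∑ i : Fin n,
      (D (Sum.inl i) x ⊗ₜ[K] E (Sum.inr i) y - D (Sum.inr i) x ⊗ₜ[K] E (Sum.inl i) y) := by
  simp [bi]

theorem bi_comm {D : Fin n ⊕ Fin n → Module.End K M} {E : Fin n ⊕ Fin n → Module.End K N}
    {f : Module.End K M} {g : Module.End K N} (hD : ∀ s, Commute f (D s))
    (hE : ∀ s, Commute g (E s)) : Commute (TensorProduct.map f g) (bi D E) :=
  Commute.sum_right _ _ _ fun _ _ =>
    (commute_map (hD _) (hE _)).sub_right (commute_map (hD _) (hE _))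

theorem bi_locNil {D : Fin n ⊕ Fin n → Module.End K M} {E : Fin n ⊕ Fin n → Module.End K N}
    (hD : ∀ s t, Commute (D s) (D t)) (hE : ∀ s t, Commute (E s) (E t))
    (h : (∀ s, IsLocNil (D s)) ∨ (∀ s, IsLocNil (E s))) : IsLocNil (bi D E) := by
  have h' : ∀ s t, IsLocNil (TensorProduct.map (D s) (E t)) := fun s t =>
    h.elim (fun h => IsLocNil.map_left (h s)) (fun h => IsLocNil.map_right (h t))
  refine IsLocNil.sum _ _ (fun i => (h' _ _).sub (h' _ _) (commute_map (hD _ _) (hE _ _))) ?_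
  intro i j
  refine Commute.sub_left (Commute.sub_right ?_ ?_) (Commute.sub_right ?_ ?_) <;>
    exact commute_map (hD _ _) (hE _ _)

theorem bi_map {D : Fin n ⊕ Fin n → Module.End K M} {E : Fin n ⊕ Fin n → Module.End K N}
    {D' : Fin n ⊕ Fin n → Module.End K M'} {E' : Fin n ⊕ Fin n → Module.End K N'}
    (f : M →ₗ[K] M') (g : N →ₗ[K] N') (hD : ∀ s, f ∘ₗ D s = D' s ∘ₗ f)
    (hE : ∀ s, g ∘ₗ E s = E' s ∘ₗ g) :
    TensorProduct.map f g ∘ₗ bi D E = bi D' E' ∘ₗ TensorProduct.map f g := by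
  have hD' : ∀ s x, f (D s x) = D' s (f x) := fun s x => LinearMap.congr_fun (hD s) x
  have hE' : ∀ s x, g (E s x) = E' s (g x) := fun s x => LinearMap.congr_fun (hE s) x
  refine TensorProduct.ext' fun a b => ?_
  simp [bi, hD', hE']

end General

variable (n : ℕ)

theorem partialD_comm (s t : Fin n ⊕ Fin n) : Commute (partialD K n s) (partialD K n t) := by
  refine LinearMap.ext fun x => ?_
  change pderiv s (pderiv t x) = pderiv t (pderiv s x)
  have h : ⁅(pderiv s : Derivation K (Poly K n) (Poly K n)),
      (pderiv t : Derivation K (Poly K n) (Poly K n))⁆ = 0 := by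
    refine MvPolynomial.derivation_ext fun i => ?_
    simp [Derivation.commutator_apply, pderiv_X, Pi.single_apply, apply_ite]
  have h' := DFunLike.congr_fun h x
  simpa [Derivation.commutator_apply, sub_eq_zero] using h'

theorem partialD_locNil (s : Fin n ⊕ Fin n) : IsLocNil (partialD K n s) := by
  intro x
  induction x using MvPolynomial.induction_on' with
  | monomial m c =>
    obtain ⟨d, hd⟩ : ∃ d, m s = d := ⟨_, rfl⟩
    refine ⟨d + 1, ?_⟩
    induction d generalizing m c with
    | zero => simp [partialD, pderiv_monomial, hd]
    | succ d ih =>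
      rw [pow_succ, Module.End.mul_apply]
      have : partialD K n s (monomial m c) = monomial (m - Finsupp.single s 1) (c * m s) :=
        pderiv_monomial
      rw [this]
      exact ih _ _ (by simp [hd])
  | add p q hp hq =>
    obtain ⟨r, hr⟩ := hp
    obtain ⟨s, hs⟩ := hq
    exact ⟨max r s, by rw [map_add, pow_zero_of_le hr (le_max_left r s),
      pow_zero_of_le hs (le_max_right r s), add_zero]⟩

theorem poisson_eq : poisson K n = bi (partialD K n) (partialD K n) := rfl

theorem poisson_locNil (h : K) : IsLocNil (h • poisson K n) :=
  (bi_locNil (partialD_comm K n) (partialD_comm K n) (Or.inl (partialD_locNil K n))).smul _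

/-- Auxiliary, for the proof of associativity: `∂ₛ ⊗ 1 + 1 ⊗ ∂ₛ`. -/
def totalD (s : Fin n ⊕ Fin n) : Module.End K (Poly K n ⊗[K] Poly K n) :=
  TensorProduct.map (partialD K n s) 1 + TensorProduct.map 1 (partialD K n s)

theorem totalD_comm (s t : Fin n ⊕ Fin n) : Commute (totalD K n s) (totalD K n t) := by
  have h := partialD_comm K n s t
  have h1 := Commute.one_right (partialD K n s)
  have h2 := Commute.one_left (partialD K n t)
  exact ((commute_map h (Commute.one_left 1)).add_right (commute_map h1 h2)).add_left
    ((commute_map h2 h1).add_right (commute_map (Commute.one_left 1) h))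

theorem poisson_comm_totalD (s : Fin n ⊕ Fin n) : Commute (poisson K n) (totalD K n s) := by
  have h1 : Commute (TensorProduct.map (partialD K n s) 1) (poisson K n) :=
    bi_comm (partialD_comm K n s) (fun _ => Commute.one_left _)
  have h2 : Commute (TensorProduct.map 1 (partialD K n s)) (poisson K n) :=
    bi_comm (fun _ => Commute.one_left _) (partialD_comm K n s)
  exact (h1.add_left h2).symm

theorem mul_totalD (s : Fin n ⊕ Fin n) :
    LinearMap.mul' K (Poly K n) ∘ₗ totalD K n s = partialD K n s ∘ₗ LinearMap.mul' K (Poly K n) := by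
  refine TensorProduct.ext' fun a b => ?_
  simp [totalD, partialD, mul_comm, add_comm]

variable {K} (h : K)

theorem one_moyal (a : Poly K n) : moyal h n 1 a = a := by
  rw [moyal, lexp_zero_of]
  · simp
  · simp [poisson, partialD, TensorProduct.map_tmul]

theorem moyal_one (a : Poly K n) : moyal h n a 1 = a := by
  rw [moyal, lexp_zero_of]
  · simp
  · simp [poisson, partialD, TensorProduct.map_tmul]

theorem add_moyal (a b c : Poly K n) : moyal h n (a + b) c = moyal h n a c + moyal h n b c := by
  simp [moyal, TensorProduct.add_tmul, lexp_add (poisson_locNil K n h)]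

theorem moyal_add (a b c : Poly K n) : moyal h n a (b + c) = moyal h n a b + moyal h n a c := by
  simp [moyal, TensorProduct.tmul_add, lexp_add (poisson_locNil K n h)]

theorem smul_moyal (k : K) (a b : Poly K n) : moyal h n (k • a) b = k • moyal h n a b := by
  simp only [moyal, ← TensorProduct.smul_tmul', lexp_smul (poisson_locNil K n h), map_smul]

theorem moyal_smul (k : K) (a b : Poly K n) : moyal h n a (k • b) = k • moyal h n a b := by
  simp only [moyal, TensorProduct.tmul_smul, lexp_smul (poisson_locNil K n h), map_smul]

theorem moyal_assoc [CharZero K] (a b c : Poly K n) :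
    moyal h n (moyal h n a b) c = moyal h n a (moyal h n b c) := by
  let P := Poly K n
  let μ : P ⊗[K] P →ₗ[K] P := LinearMap.mul' K P
  let α : Module.End K (P ⊗[K] P) := h • poisson K n
  let B₁ : Module.End K ((P ⊗[K] P) ⊗[K] P) := h • bi (totalD K n) (partialD K n)
  let B₂ : Module.End K (P ⊗[K] (P ⊗[K] P)) := h • bi (partialD K n) (totalD K n)
  let A₁ : Module.End K ((P ⊗[K] P) ⊗[K] P) := TensorProduct.map α 1
  let A₂ : Module.End K (P ⊗[K] (P ⊗[K] P)) := TensorProduct.map 1 α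
  have hα : IsLocNil α := poisson_locNil K n h
  have hB₁ : IsLocNil (K := K) (M := (P ⊗[K] P) ⊗[K] P) B₁ :=
    IsLocNil.smul (bi_locNil (totalD_comm K n) (partialD_comm K n)
      (Or.inr (partialD_locNil K n))) h
  have hB₂ : IsLocNil (K := K) (M := P ⊗[K] (P ⊗[K] P)) B₂ :=
    IsLocNil.smul (bi_locNil (partialD_comm K n) (totalD_comm K n)
      (Or.inl (partialD_locNil K n))) h
  have hA₁ : IsLocNil (K := K) (M := (P ⊗[K] P) ⊗[K] P) A₁ := hα.map_left
  have hA₂ : IsLocNil (K := K) (M := P ⊗[K] (P ⊗[K] P)) A₂ := hα.map_right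
  have hc₁ : Commute B₁ A₁ :=
    ((bi_comm (fun s => (poisson_comm_totalD K n s).smul_left h)
      (fun s => Commute.one_left _)).smul_right h).symm
  have hc₂ : Commute B₂ A₂ :=
    ((bi_comm (fun s => Commute.one_left _)
      (fun s => (poisson_comm_totalD K n s).smul_left h)).smul_right h).symm
  have e₁ : (lexp α (a ⊗ₜ[K] b)) ⊗ₜ[K] c = lexp A₁ ((a ⊗ₜ[K] b) ⊗ₜ[K] c) :=
    (lexp_map (M := P ⊗[K] P) (N := (P ⊗[K] P) ⊗[K] P) (f := α) (g := A₁)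
      ((TensorProduct.mk K (P ⊗[K] P) P).flip c) hα
      (LinearMap.ext fun x => by simp [A₁]) (a ⊗ₜ[K] b)).symm
  have e₂ : a ⊗ₜ[K] (lexp α (b ⊗ₜ[K] c)) = lexp A₂ (a ⊗ₜ[K] (b ⊗ₜ[K] c)) :=
    (lexp_map (M := P ⊗[K] P) (N := P ⊗[K] (P ⊗[K] P)) (f := α) (g := A₂)
      (TensorProduct.mk K P (P ⊗[K] P) a) hα
      (LinearMap.ext fun x => by simp [A₂]) (b ⊗ₜ[K] c)).symm
  have i₁ : TensorProduct.map μ LinearMap.id ∘ₗ B₁ = α ∘ₗ TensorProduct.map μ LinearMap.id := by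
    have := bi_map (D' := partialD K n) (E' := partialD K n) μ (LinearMap.id : P →ₗ[K] P)
      (mul_totalD K n) (E := partialD K n) (fun s => rfl)
    simp only [B₁, α, LinearMap.comp_smul, LinearMap.smul_comp, poisson_eq, this]
  have i₂ : TensorProduct.map LinearMap.id μ ∘ₗ B₂ = α ∘ₗ TensorProduct.map LinearMap.id μ := by
    have := bi_map (D' := partialD K n) (E' := partialD K n) (LinearMap.id : P →ₗ[K] P) μ
      (D := partialD K n) (fun s => rfl) (mul_totalD K n)
    simp only [B₂, α, LinearMap.comp_smul, LinearMap.smul_comp, poisson_eq, this]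
  have l₁ : moyal h n (moyal h n a b) c = μ (TensorProduct.map μ LinearMap.id
      (lexp (B₁ + A₁) ((a ⊗ₜ[K] b) ⊗ₜ[K] c))) := by
    rw [lexp_add_comm hB₁ hA₁ hc₁, ← e₁, ← lexp_map _ hB₁ i₁]
    rfl
  have l₂ : moyal h n a (moyal h n b c) = μ (TensorProduct.map LinearMap.id μ
      (lexp (B₂ + A₂) (a ⊗ₜ[K] (b ⊗ₜ[K] c)))) := by
    rw [lexp_add_comm hB₂ hA₂ hc₂, ← e₂, ← lexp_map _ hB₂ i₂]
    rfl
  have has : (TensorProduct.assoc K P P P).toLinearMap ∘ₗ (B₁ + A₁) =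
      (B₂ + A₂) ∘ₗ (TensorProduct.assoc K P P P).toLinearMap := by
    refine TensorProduct.ext_threefold fun x y z => ?_
    have b₁ := bi_tmul (totalD K n) (partialD K n) (x ⊗ₜ[K] y) z
    have b₂ := bi_tmul (partialD K n) (totalD K n) x (y ⊗ₜ[K] z)
    simp only [B₁, A₁, B₂, A₂, α, b₁, b₂, bi_tmul, poisson_eq, totalD, LinearMap.comp_apply,
      LinearMap.add_apply, LinearMap.smul_apply, TensorProduct.map_tmul,
      LinearEquiv.coe_coe, map_add, map_smul, map_sum, map_sub, TensorProduct.assoc_tmul,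
      TensorProduct.add_tmul, TensorProduct.tmul_add, TensorProduct.sum_tmul,
      TensorProduct.tmul_sum, TensorProduct.sub_tmul, TensorProduct.tmul_sub,
      ← TensorProduct.smul_tmul', TensorProduct.tmul_smul, Module.End.one_apply, ← smul_add,
      ← Finset.sum_add_distrib]
    congr 1
    refine Finset.sum_congr rfl fun i _ => ?_
    abel
  have hm : μ ∘ₗ TensorProduct.map μ LinearMap.id =
      μ ∘ₗ TensorProduct.map LinearMap.id μ ∘ₗ (TensorProduct.assoc K P P P).toLinearMap := by
    refine TensorProduct.ext_threefold fun x y z => ?_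
    simp [μ, mul_assoc]
  rw [l₁, l₂, ← TensorProduct.assoc_tmul, ← LinearEquiv.coe_coe,
    lexp_map _ (hB₁.add hA₁ hc₁) has]
  exact LinearMap.congr_fun hm _

/-- The Weyl algebra with parameter `h`: the vector space `K[p₁, …, pₙ, q₁, …, qₙ]` with the Moyal
product `⋆` as multiplication. -/
def WeylAlgebra {K : Type} [Field K] (_h : K) (n : ℕ) : Type := Poly K n

instance : AddCommGroup (WeylAlgebra h n) := inferInstanceAs (AddCommGroup (Poly K n))
instance : Module K (WeylAlgebra h n) := inferInstanceAs (Module K (Poly K n))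

instance [CharZero K] : Ring (WeylAlgebra h n) where
  __ := (inferInstance : AddCommGroup (WeylAlgebra h n))
  mul := moyal h n
  one := (1 : Poly K n)
  left_distrib := moyal_add n h
  right_distrib := add_moyal n h
  zero_mul a := by
    have := smul_moyal n h 0 (0 : Poly K n) a
    rwa [zero_smul K (moyal h n 0 a), zero_smul] at this
  mul_zero a := by
    have := moyal_smul n h 0 a (0 : Poly K n)
    rwa [zero_smul K (moyal h n a 0), zero_smul] at this
  mul_assoc := moyal_assoc n h
  one_mul := one_moyal n h
  mul_one := moyal_one n h

instance [CharZero K] : Algebra K (WeylAlgebra h n) :=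
  Algebra.ofModule (smul_moyal n h) (fun c a b => moyal_smul n h c a b)

variable {n}
variable (ρ : ℝ →+* K)
open Matrix

/-- The action of a linear symplectic transformation `γ` on polynomial functions, `f ↦ f ∘ γ⁻¹`: the
coordinate function `x_s` goes to `∑ₜ (γ⁻¹)_{st} x_t`. Real numbers are read in `K` through `ρ`. -/
def subst (γ : symplecticGroup (Fin n) ℝ) : Poly K n →ₐ[K] Poly K n :=
  aeval fun s => ∑ t, C (ρ ((γ⁻¹ : symplecticGroup (Fin n) ℝ).1 s t)) * X t

theorem subst_one : subst ρ (1 : symplecticGroup (Fin n) ℝ) = AlgHom.id K (Poly K n) := by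
  refine MvPolynomial.algHom_ext fun s => ?_
  simp [subst, Matrix.one_apply, apply_ite ρ]

theorem subst_mul (γ δ : symplecticGroup (Fin n) ℝ) :
    subst ρ (γ * δ) = (subst ρ γ).comp (subst ρ δ) := by
  refine MvPolynomial.algHom_ext fun s => ?_
  have hC : ∀ c : K, (subst ρ γ) (C c) = C c := fun c => (subst ρ γ).commutes c
  have hX : ∀ (ε : symplecticGroup (Fin n) ℝ) (t : Fin n ⊕ Fin n), subst ρ ε (X t) =
      ∑ u, C (ρ ((ε⁻¹ : symplecticGroup (Fin n) ℝ).1 t u)) * X u := fun ε t => by simp [subst]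
  rw [AlgHom.comp_apply, hX, hX]
  simp only [map_sum, map_mul, hC, hX, _root_.mul_inv_rev, Submonoid.coe_mul, Matrix.mul_apply,
    Finset.sum_mul, Finset.mul_sum]
  rw [Finset.sum_comm]
  simp only [mul_assoc]

theorem partialD_subst (γ : symplecticGroup (Fin n) ℝ) (s : Fin n ⊕ Fin n) (f : Poly K n) :
    partialD K n s (subst ρ γ f) =
      ∑ t, ρ ((γ⁻¹ : symplecticGroup (Fin n) ℝ).1 t s) • subst ρ γ (partialD K n t f) := by
  induction f using MvPolynomial.induction_on with
  | C c =>
    have hC : (subst ρ γ) (C c) = C c := (subst ρ γ).commutes c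
    simp [hC, partialD]
  | add p q hp hq =>
    simp only [map_add, hp, hq, smul_add, Finset.sum_add_distrib]
  | mul_X p t hp =>
    have hX : partialD K n s (subst ρ γ (X t)) =
        C (ρ ((γ⁻¹ : symplecticGroup (Fin n) ℝ).1 t s)) := by
      simp [subst, partialD, pderiv_X, Pi.single_apply, -Fintype.sum_sum_type]
    have hl : ∀ (u : Fin n ⊕ Fin n) (f g : Poly K n),
      partialD K n u (f * g) = partialD K n u f * g + f * partialD K n u g := fun u f g => pderiv_mul
    have hXX : ∀ u, partialD K n u (X t : Poly K n) = if t = u then 1 else 0 := fun u => by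
      simp [partialD, pderiv_X, Pi.single_apply]
    rw [map_mul, hl, hX, hp]
    simp only [hl, hXX, map_add, map_mul, smul_add, Finset.sum_add_distrib, Finset.sum_mul,
      smul_mul_assoc, mul_ite, mul_one, mul_zero, apply_ite (subst ρ γ), map_zero, smul_ite,
      smul_zero, Finset.sum_ite_eq, Finset.mem_univ, if_true]
    rw [mul_comm (subst ρ γ p), C_mul']

theorem sum_J {V : Type*} [AddCommGroup V] [Module K V]
    (T : Fin n ⊕ Fin n → Fin n ⊕ Fin n → V) :
    ∑ i : Fin n, (T (Sum.inl i) (Sum.inr i) - T (Sum.inr i) (Sum.inl i)) =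
      -∑ s, ∑ t, ρ (J (Fin n) ℝ s t) • T s t := by
  have e : ∀ i j : Fin n, ρ (-if i = j then 1 else 0) = if i = j then -1 else 0 := by
    intro i j; split_ifs <;> simp
  simp only [J, Fintype.sum_sum_type, Matrix.fromBlocks_apply₁₁,
    Matrix.fromBlocks_apply₁₂, Matrix.fromBlocks_apply₂₁, Matrix.fromBlocks_apply₂₂,
    Matrix.zero_apply, Matrix.neg_apply, Matrix.one_apply, e, apply_ite ρ, map_zero, map_one,
    zero_smul, ite_smul, one_smul, neg_smul, Finset.sum_const_zero, Finset.sum_ite_eq,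
    Finset.mem_univ, if_true, zero_add, add_zero, Finset.sum_sub_distrib, Finset.sum_neg_distrib]
  abel

theorem sum_J_conj {V : Type*} [AddCommGroup V] [Module K V]
    (γ : symplecticGroup (Fin n) ℝ) (T : Fin n ⊕ Fin n → Fin n ⊕ Fin n → V) :
    ∑ s, ∑ t, ρ (J (Fin n) ℝ s t) • ∑ u, ∑ v, (ρ (γ.1 u s) * ρ (γ.1 v t)) • T u v =
      ∑ u, ∑ v, ρ (J (Fin n) ℝ u v) • T u v := by
  have hR : ∀ u v, ρ (J (Fin n) ℝ u v) = ∑ s, ∑ t,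
      ρ (J (Fin n) ℝ s t) * (ρ (γ.1 u s) * ρ (γ.1 v t)) := by
    intro u v
    conv_lhs => rw [← SymplecticGroup.mem_iff.1 γ.2]
    simp only [Matrix.mul_apply, Matrix.transpose_apply, Finset.sum_mul, map_sum, map_mul]
    rw [Finset.sum_comm]
    refine Finset.sum_congr rfl fun s _ => Finset.sum_congr rfl fun t _ => by ring
  simp only [Finset.smul_sum, smul_smul]
  calc _ = ∑ s, ∑ u, ∑ t, ∑ v, (ρ (J (Fin n) ℝ s t) * (ρ (γ.1 u s) * ρ (γ.1 v t))) • T u v :=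
        Finset.sum_congr rfl fun s _ => Finset.sum_comm
    _ = ∑ u, ∑ s, ∑ t, ∑ v, (ρ (J (Fin n) ℝ s t) * (ρ (γ.1 u s) * ρ (γ.1 v t))) • T u v :=
        Finset.sum_comm
    _ = ∑ u, ∑ s, ∑ v, ∑ t, (ρ (J (Fin n) ℝ s t) * (ρ (γ.1 u s) * ρ (γ.1 v t))) • T u v :=
        Finset.sum_congr rfl fun u _ => Finset.sum_congr rfl fun s _ => Finset.sum_comm
    _ = ∑ u, ∑ v, ∑ s, ∑ t, (ρ (J (Fin n) ℝ s t) * (ρ (γ.1 u s) * ρ (γ.1 v t))) • T u v :=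
        Finset.sum_congr rfl fun u _ => Finset.sum_comm
    _ = _ := Finset.sum_congr rfl fun u _ => Finset.sum_congr rfl fun v _ => by
        rw [hR u v, Finset.sum_smul]
        exact Finset.sum_congr rfl fun s _ => (Finset.sum_smul).symm

theorem poisson_tmul (a b : Poly K n) : poisson K n (a ⊗ₜ[K] b) =
    -∑ s, ∑ t, ρ (J (Fin n) ℝ s t) • (partialD K n s a ⊗ₜ[K] partialD K n t b) := by
  rw [← sum_J ρ (fun s t => partialD K n s a ⊗ₜ[K] partialD K n t b)]
  simp [poisson]

theorem poisson_subst (γ : symplecticGroup (Fin n) ℝ) :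
    TensorProduct.map (subst ρ γ).toLinearMap (subst ρ γ).toLinearMap ∘ₗ poisson K n =
      poisson K n ∘ₗ TensorProduct.map (subst ρ γ).toLinearMap (subst ρ γ).toLinearMap := by
  refine TensorProduct.ext' fun a b => ?_
  have hT : ∀ s t, partialD K n s (subst ρ γ a) ⊗ₜ[K] partialD K n t (subst ρ γ b) =
      ∑ u, ∑ v, (ρ ((γ⁻¹ : symplecticGroup (Fin n) ℝ).1 u s) *
        ρ ((γ⁻¹ : symplecticGroup (Fin n) ℝ).1 v t)) •
          (subst ρ γ (partialD K n u a) ⊗ₜ[K] subst ρ γ (partialD K n v b)) := by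
    intro s t
    rw [partialD_subst, partialD_subst, TensorProduct.sum_tmul]
    refine Finset.sum_congr rfl fun u _ => ?_
    rw [TensorProduct.tmul_sum]
    refine Finset.sum_congr rfl fun v _ => ?_
    rw [TensorProduct.tmul_smul, ← TensorProduct.smul_tmul', smul_smul, mul_comm]
  have hL : TensorProduct.map (subst ρ γ).toLinearMap (subst ρ γ).toLinearMap
      (poisson K n (a ⊗ₜ[K] b)) = -∑ s, ∑ t, ρ (J (Fin n) ℝ s t) •
        (subst ρ γ (partialD K n s a) ⊗ₜ[K] subst ρ γ (partialD K n t b)) := by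
    rw [poisson_tmul ρ, map_neg]
    simp only [map_sum, map_smul, TensorProduct.map_tmul, AlgHom.toLinearMap_apply]
  rw [LinearMap.comp_apply, LinearMap.comp_apply, hL, TensorProduct.map_tmul,
    AlgHom.toLinearMap_apply, AlgHom.toLinearMap_apply, poisson_tmul ρ]
  simp only [hT]
  rw [sum_J_conj ρ γ⁻¹ (fun u v =>
    subst ρ γ (partialD K n u a) ⊗ₜ[K] subst ρ γ (partialD K n v b))]

theorem subst_moyal (γ : symplecticGroup (Fin n) ℝ) (a b : Poly K n) :
    subst ρ γ (moyal h n a b) = moyal h n (subst ρ γ a) (subst ρ γ b) := by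
  have h := lexp_map (g := h • poisson K n)
    (TensorProduct.map (subst ρ γ).toLinearMap (subst ρ γ).toLinearMap) (poisson_locNil K n h)
    (by rw [LinearMap.comp_smul, LinearMap.smul_comp, poisson_subst]) (a ⊗ₜ[K] b)
  rw [TensorProduct.map_tmul] at h
  simp only [AlgHom.toLinearMap_apply] at h
  rw [moyal, moyal, h]
  have hm : (subst ρ γ).toLinearMap ∘ₗ LinearMap.mul' K (Poly K n) = LinearMap.mul' K (Poly K n) ∘ₗ
      TensorProduct.map (subst ρ γ).toLinearMap (subst ρ γ).toLinearMap :=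
    TensorProduct.ext' fun x y => by simp
  exact LinearMap.congr_fun hm _

/-- The action of `γ` as an endomorphism of the Weyl algebra. -/
def actHom [CharZero K] (γ : symplecticGroup (Fin n) ℝ) : WeylAlgebra h n →ₐ[K] WeylAlgebra h n :=
  AlgHom.ofLinearMap ((subst ρ γ).toLinearMap : Poly K n →ₗ[K] Poly K n)
    (map_one (subst ρ γ)) (subst_moyal h ρ γ)

/-- The automorphism of the Weyl algebra induced by a linear symplectic transformation `γ`. -/
def act [CharZero K] (γ : symplecticGroup (Fin n) ℝ) : WeylAlgebra h n ≃ₐ[K] WeylAlgebra h n :=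
  AlgEquiv.ofAlgHom (actHom h ρ γ) (actHom h ρ γ⁻¹)
    (AlgHom.ext fun x => by
      have := (AlgHom.congr_fun (subst_mul ρ γ γ⁻¹) x).symm
      rwa [mul_inv_cancel, subst_one] at this)
    (AlgHom.ext fun x => by
      have := (AlgHom.congr_fun (subst_mul ρ γ⁻¹ γ) x).symm
      rwa [inv_mul_cancel, subst_one] at this)

/-- The field `𝕂 = ℂ((ħ))` of formal Laurent series. -/
abbrev KK : Type := LaurentSeries ℂ

/-- The formal parameter `ħ`. -/
def hbar : KK := HahnSeries.single (1 : ℤ) (1 : ℂ)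

/-- The inclusion `ℝ ⊆ ℂ ⊆ ℂ((ħ))` as constant series. -/
def realToKK : ℝ →+* KK := (HahnSeries.C : ℂ →+* KK).comp Complex.ofRealHom

instance : CharZero KK := charZero_of_injective_ringHom realToKK.injective

/-- The automorphism of the Weyl algebra `𝕎_{2n} = WeylAlgebra hbar n` over `ℂ((ħ))` induced by
`γ ∈ Sp_{2n}(ℝ)`. -/
abbrev sympAut (γ : symplecticGroup (Fin n) ℝ) :
    WeylAlgebra hbar n ≃ₐ[KK] WeylAlgebra hbar n :=
  act hbar realToKK γ

/-- The fixed point space `ker (γ - 1) ⊆ ℝ²ⁿ`. -/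
def fixedSpace (γ : symplecticGroup (Fin n) ℝ) : Submodule ℝ (Fin n ⊕ Fin n → ℝ) :=
  LinearMap.ker (Matrix.toLin' γ.1 - LinearMap.id)

end

end Weyl

/-!
Let `A` be the Weyl algebra, over a field `K` of characteristic zero, and let `v₁, …, v_N` be a
basis of the linear forms, `N = 2n`. Since the commutators of the `vᵢ` are scalars and `γ` fixes
scalars, the operators `a ↦ a vᵢ - γ⁻¹(vᵢ) a`, in which the left and the right multiplication act
on the two outer factors of a tensor power `A ⊗ ⋯ ⊗ A`, commute with one another
(`Bar.twistedComm_commute`). So the bar resolution `⋯ → A ⊗ A ⊗ A → A ⊗ A` of `A` is a complex of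
modules over the polynomial ring `R = K[X₁, …, X_N]`. Since the `vᵢ` generate `A`, its quotient by
the images of the `Xᵢ` is the complex which computes `H_•(A, A_γ)` (`Bar.proj`,
`Bar.mem_of_proj_eq_zero`).

The derivatives dual to the `vᵢ`, acting on the last factor, form Heisenberg pairs with the `Xᵢ`, so
`X₁, …, X_N` is a weakly regular sequence on every term of the bar resolution
(`Heisenberg.isWeaklyRegular`). One divides by the `Xᵢ` one at a time. By the long exact sequence of
`0 → C → C → C / XᵢC → 0`, if the homology of `C` is concentrated in one degree, and if `Xᵢ` is
injective there, then the homology of `C / XᵢC` is the cokernel of `Xᵢ`, in the same degree; if `Xᵢ`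
is surjective, it is the kernel of `Xᵢ`, one degree higher
(`CollapsingHomology.homology_of_collapses`).

The process starts with the homology of the bar resolution, which is `A` in degree zero. On `A`, the
operator `Xᵢ` is multiplication by the linear form `vᵢ - γ⁻¹(vᵢ)`, for the commutative product,
minus `h` times a derivative along a constant vector field (`Weyl.moyal_lin_sub`). Choose the basis
such that the first `v₁, …, v_d` span the linear forms fixed by `γ`; these form a space of the same
dimension `d` as the fixed points of `γ`. Then `X₁, …, X_d` are multiples of derivatives; the other
`Xᵢ` contain multiplications by linear forms which are linearly independent. Because `γ` is
symplectic, these forms are killed by the derivatives `X₁, …, X_d`, and they extend to a basis which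
makes `A` a Fock space with vacuum `1`, on which `X₁, …, X_d` are annihilation operators and the
others creation operators (`exists_adapted_bases`, `Weyl.twistedHomology_of_adaptedBases`).
Annihilation operators are surjective and creation operators injective, so what is left in the end
is the line spanned by the vacuum, in degree `d` (`Heisenberg.collapses`).
-/

universe v

/-! ### Heisenberg pairs of operators -/

namespace Heisenberg

open scoped Pointwise

section Pair

variable {M : Type*} [AddCommGroup M] {r s : M →+ M}

theorem iterate_apply (h : ∀ x, s (r x) = r (s x) + x) (k : ℕ) (x : M) :
    s^[k + 1] (r x) = r (s^[k + 1] x) + (k + 1) • s^[k] x := by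
  induction k generalizing x with
  | zero => simp [h]
  | succ k ih =>
    rw [Function.iterate_succ_apply, h, iterate_map_add, ih, ← Function.iterate_succ_apply,
      ← Function.iterate_succ_apply, add_assoc, ← succ_nsmul]

/-- If `s r - r s = 1` and `s` is locally nilpotent, then `s r` is injective: `s r x = 0` and
`sᵏ⁺¹ x = 0` give `(k + 1) sᵏ x = 0`. -/
theorem eq_zero_of_apply_apply (hM : ∀ k : ℕ, k ≠ 0 → Function.Bijective fun x : M => k • x)
    (h : ∀ x, s (r x) = r (s x) + x) (hs : ∀ x, ∃ k : ℕ, s^[k] x = 0) {x : M}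
    (hx : s (r x) = 0) : x = 0 := by
  obtain ⟨k, hk⟩ := hs x
  induction k with
  | zero => simpa using hk
  | succ k ih =>
    refine ih ((hM (k + 1) k.succ_ne_zero).1 ?_)
    have := iterate_apply h k x
    rw [hk, map_zero, zero_add, Function.iterate_succ_apply, hx, iterate_map_zero] at this
    simp [← this]

/-- The whole space is the sum of the kernel of `s` and the image of `r`. -/
theorem exists_add (hM : ∀ k : ℕ, k ≠ 0 → Function.Bijective fun x : M => k • x)
    (h : ∀ x, s (r x) = r (s x) + x) (hs : ∀ x, ∃ k : ℕ, s^[k] x = 0) (x : M) :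
    ∃ a b, s a = 0 ∧ x = a + r b := by
  obtain ⟨k, hk⟩ := hs x
  induction k generalizing x with
  | zero => exact ⟨0, 0, map_zero s, by simpa using hk⟩
  | succ k ih =>
    rcases k with - | k
    · exact ⟨x, 0, hk, by simp⟩
    -- `(k + 1) x - r (s x)` is killed by a smaller power of `s`
    have h1 : s^[k + 1] ((k + 1) • x - r (s x)) = 0 := by
      rw [iterate_map_sub, iterate_map_nsmul, iterate_apply h, ← Function.iterate_succ_apply,
        ← Function.iterate_succ_apply, hk, map_zero, zero_add, sub_self]
    obtain ⟨a, b, ha, hab⟩ := ih _ h1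
    obtain ⟨a', ha'⟩ := (hM (k + 1) k.succ_ne_zero).2 a
    obtain ⟨b', hb'⟩ := (hM (k + 1) k.succ_ne_zero).2 (b + s x)
    simp only at ha' hb'
    refine ⟨a', b', (hM (k + 1) k.succ_ne_zero).1 ?_, (hM (k + 1) k.succ_ne_zero).1 ?_⟩
    · simp only [← map_nsmul, ha', ha, nsmul_zero]
    · simp only [nsmul_add, ← map_nsmul, ha', hb', map_add]
      rw [← add_assoc, ← hab, sub_add_cancel]

theorem surjective (hM : ∀ k : ℕ, k ≠ 0 → Function.Bijective fun x : M => k • x)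
    (h : ∀ x, s (r x) = r (s x) + x) (hs : ∀ x, ∃ k : ℕ, s^[k] x = 0) :
    Function.Surjective s := by
  intro x
  obtain ⟨k, hk⟩ := hs x
  induction k generalizing x with
  | zero => exact ⟨0, by simpa using hk.symm⟩
  | succ k ih =>
    -- `(k + 1) x` is the sum of `s (r x)` and of `k x - r (s x)`, which is killed by `sᵏ`
    have h1 : s^[k] (k • x - r (s x)) = 0 := by
      rcases k with - | k
      · simp only [Function.iterate_one, zero_add] at hk
        simp [hk]
      rw [iterate_map_sub, iterate_map_nsmul, iterate_apply h, ← Function.iterate_succ_apply,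
        ← Function.iterate_succ_apply, hk, map_zero, zero_add, sub_self]
    obtain ⟨y, hy⟩ := ih _ h1
    obtain ⟨z, hz⟩ := (hM (k + 1) k.succ_ne_zero).2 (r x + y)
    refine ⟨z, (hM (k + 1) k.succ_ne_zero).1 ?_⟩
    simp only at hz ⊢
    rw [← map_nsmul, hz, map_add, hy, h, succ_nsmul]
    abel

end Pair

/-- An additive map which preserves the kernel of a surjection descends along it. -/
theorem exists_descend {M N : Type*} [AddCommGroup M] [AddCommGroup N] (p : M →+ N)
    (hp : Function.Surjective p) (s : M →+ M) (hs : ∀ x, p x = 0 → p (s x) = 0) :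
    ∃ s' : N →+ N, ∀ x, s' (p x) = p (s x) := by
  refine ⟨p.liftOfSurjective hp ⟨p.comp s, fun x hx => hs x hx⟩, fun x => ?_⟩
  exact p.liftOfRightInverse_comp_apply _ _ ⟨p.comp s, fun x hx => hs x hx⟩ x

theorem bijective_nsmul (K : Type*) {R : Type*} [Field K] [CharZero K] [CommRing R] [Algebra K R]
    {M : Type*} [AddCommGroup M] [Module R M] (k : ℕ) (hk : k ≠ 0) :
    Function.Bijective fun x : M => k • x := by
  have hk' : (k : K) ≠ 0 := Nat.cast_ne_zero.2 hk
  have e : ∀ x : M, k • x = algebraMap K R k • x := fun x => by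
    rw [map_natCast, Nat.cast_smul_eq_nsmul]
  refine Function.bijective_iff_has_inverse.2 ⟨fun x => algebraMap K R (k : K)⁻¹ • x, ?_, ?_⟩
  · intro x
    simp only [e]
    rw [smul_smul, ← map_mul, inv_mul_cancel₀ hk', map_one, one_smul]
  · intro x
    simp only [e]
    rw [smul_smul, ← map_mul, mul_inv_cancel₀ hk', map_one, one_smul]

theorem mem_smul_top {R : Type*} [CommRing R] {M : Type*} [AddCommGroup M] [Module R M] {r : R}
    {x : M} : x ∈ r • (⊤ : Submodule R M) ↔ ∃ y, x = r • y := by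
  rw [Submodule.mem_smul_pointwise_iff_exists]
  simp [eq_comm]

/-- A sequence of ring elements acting like the creation operators of a Heisenberg algebra is
weakly regular. -/
theorem isWeaklyRegular (K : Type*) {R : Type*} [Field K] [CharZero K] [CommRing R]
    [Algebra K R] {m : ℕ} {M : Type v} [AddCommGroup M] [Module R M] (r : Fin m → R)
    (s : Fin m → M →+ M)
    (h : ∀ i j x, s i (r j • x) = r j • s i x + if i = j then x else 0)
    (hs : ∀ i x, ∃ k : ℕ, (s i)^[k] x = 0) :
    RingTheory.Sequence.IsWeaklyRegular M (List.ofFn r) := by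
  induction m generalizing M with
  | zero => simp
  | succ m ih =>
    have hM := bijective_nsmul K (R := R) (M := M)
    have h0 : ∀ x, s 0 (DistribSMul.toAddMonoidHom M (r 0) x) =
        DistribSMul.toAddMonoidHom M (r 0) (s 0 x) + x := fun x => by simpa using h 0 0 x
    rw [List.ofFn_succ]
    refine .cons ?_ ?_
    · refine isSMulRegular_iff_right_eq_zero_of_smul.2 fun x hx => ?_
      refine eq_zero_of_apply_apply hM h0 (hs 0) (x := x) ?_
      change s 0 (r 0 • x) = 0
      rw [hx, map_zero]
    · have hd : ∀ i : Fin m, ∃ s' : QuotSMulTop (r 0) M →+ QuotSMulTop (r 0) M, ∀ x,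
          s' (Submodule.Quotient.mk x) = Submodule.Quotient.mk (s i.succ x) := by
        intro i
        refine exists_descend (Submodule.mkQ (r 0 • (⊤ : Submodule R M))).toAddMonoidHom
          (Submodule.mkQ_surjective _) (s i.succ) fun x hx => ?_
        simp only [LinearMap.toAddMonoidHom_coe, Submodule.mkQ_apply,
          Submodule.Quotient.mk_eq_zero, mem_smul_top] at hx ⊢
        obtain ⟨y, rfl⟩ := hx
        exact ⟨s i.succ y, by rw [h]; simp [Fin.succ_ne_zero]⟩
      choose s' hs' using hd
      refine ih (fun i => r i.succ) s' ?_ ?_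
      · intro i j x
        obtain ⟨x, rfl⟩ := Submodule.Quotient.mk_surjective _ x
        rw [hs', ← Submodule.Quotient.mk_smul, hs', h]
        by_cases hij : i = j <;> simp [hij]
      · intro i x
        obtain ⟨x, rfl⟩ := Submodule.Quotient.mk_surjective _ x
        obtain ⟨k, hk⟩ := hs i.succ x
        refine ⟨k, ?_⟩
        have : Function.Semiconj (Submodule.Quotient.mk (p := r 0 • (⊤ : Submodule R M)))
          (s i.succ) (s' i) := fun y => (hs' i y).symm
        rw [← (this.iterate_right k).eq x, hk, Submodule.Quotient.mk_zero]

end Heisenberg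

/-- The condition that an `R`-module `M` is reduced to the base field `K` by successively passing,
for each member `r` of a list, either to the cokernel of an injective `r` or to the kernel of a
surjective `r`, the second alternative being taken `d` times. The algebra map makes the last module
a vector space over `K`; the module itself and the ones on the way are only given up to isomorphism,
through the quotient map or the inclusion `f`. -/
def Collapses (K : Type*) {R : Type*} [Field K] [CommRing R] [Algebra K R] :
    List R → ℕ → ModuleCat.{v} R → Prop
  | [], d, M => d = 0 ∧ ∃ e : M ≃+ K, ∀ (c : K) (x : M), e (algebraMap K R c • x) = c * e x
  | r :: rs, d, M =>
    (∃ (N : ModuleCat.{v} R) (f : M →ₗ[R] N), (∀ x : M, r • x = 0 → x = 0) ∧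
      Function.Surjective f ∧ (∀ x, f x = 0 ↔ ∃ y, x = r • y) ∧ Collapses K rs d N) ∨
    (∃ (d' : ℕ) (N : ModuleCat.{v} R) (f : N →ₗ[R] M), d = d' + 1 ∧
      (∀ x : M, ∃ y, x = r • y) ∧ Function.Injective f ∧ (∀ x, (∃ y, x = f y) ↔ r • x = 0) ∧
      Collapses K rs d' N)

theorem Collapses.congr {K R : Type*} [Field K] [CommRing R] [Algebra K R] {rs : List R} {d : ℕ}
    {M N : ModuleCat.{v} R} (e : M ≃ₗ[R] N) (h : Collapses K rs d M) : Collapses K rs d N := by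
  cases rs with
  | nil =>
    obtain ⟨h0, f, hf⟩ := h
    refine ⟨h0, e.symm.toAddEquiv.trans f, fun c x => ?_⟩
    simpa using hf c (e.symm x)
  | cons r rs =>
    rcases h with ⟨N', f, h1, h2, h3, h4⟩ | ⟨d', N', f, h0, h1, h2, h3, h4⟩
    · refine .inl ⟨N', f ∘ₗ e.symm.toLinearMap, fun x hx => ?_, h2.comp e.symm.surjective,
        fun x => ?_, h4⟩
      · have := h1 (e.symm x) (by rw [← map_smul, hx, map_zero])
        simpa using this
      · rw [LinearMap.comp_apply, LinearEquiv.coe_coe, h3]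
        refine ⟨fun ⟨y, hy⟩ => ⟨e y, ?_⟩, fun ⟨y, hy⟩ => ⟨e.symm y, ?_⟩⟩
        · rw [← map_smul, ← hy, LinearEquiv.apply_symm_apply]
        · rw [hy, map_smul]
    · refine .inr ⟨d', N', e.toLinearMap ∘ₗ f, h0, fun x => ?_, e.injective.comp h2,
        fun x => ?_, h4⟩
      · obtain ⟨y, hy⟩ := h1 (e.symm x)
        exact ⟨e y, by rw [← map_smul, ← hy, LinearEquiv.apply_symm_apply]⟩
      · have : r • x = 0 ↔ r • e.symm x = 0 := by
          rw [← map_smul, LinearEquiv.map_eq_zero_iff]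
        rw [this, ← h3]
        refine exists_congr fun y => ?_
        rw [LinearEquiv.symm_apply_eq, LinearMap.comp_apply, LinearEquiv.coe_coe]

namespace Heisenberg

open scoped Pointwise

variable (K : Type*) {R : Type*} [Field K] [CharZero K] [CommRing R] [Algebra K R]

/-- A Fock space collapses to the line spanned by its vacuum `Ω`. The elements `r i` of the ring
act as annihilators where `b i` holds and as creators elsewhere; `s i` is the partner of `r i`, an
operator of the opposite kind. The annihilators come first (`hmono`), and only relations between
`r i` and `s j` with `i ≤ j` are needed, since `s j` has to survive the passage to the kernel or the
cokernel of `r i` for `i < j`. -/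
theorem collapses {m : ℕ} (M : ModuleCat.{v} R) (b : Fin m → Prop) [DecidablePred b]
    (r : Fin m → R) (s : Fin m → M →+ M) (Ω : M)
    (h : ∀ i j x, i ≤ j → s j (r i • x) + (if b i ∧ i = j then x else 0) =
      r i • s j x + if ¬ b i ∧ i = j then x else 0)
    (hcomm : ∀ i j x, ¬ b i → ¬ b j → s i (s j x) = s j (s i x))
    (hmono : ∀ i j, b j → ¬ b i → j < i)
    (hr : ∀ i, b i → ∀ x : M, ∃ k : ℕ, (fun y => r i • y)^[k] x = 0)
    (hs : ∀ i, ¬ b i → ∀ x : M, ∃ k : ℕ, (s i)^[k] x = 0)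
    (hΩ : Ω ≠ 0) (hΩr : ∀ i, b i → r i • Ω = 0) (hΩs : ∀ i, ¬ b i → s i Ω = 0)
    (huniq : ∀ x : M, (∀ i, b i → r i • x = 0) → (∀ i, ¬ b i → s i x = 0) →
      ∃ c : K, x = algebraMap K R c • Ω) :
    Collapses K (List.ofFn r) (∑ i, if b i then 1 else 0) M := by
  induction m generalizing M with
  | zero =>
    rw [List.ofFn_zero]
    refine ⟨by simp, ?_⟩
    have hinj : ∀ c : K, algebraMap K R c • Ω = 0 → c = 0 := by
      intro c hc
      by_contra h0
      apply hΩ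
      have := congrArg (fun x => algebraMap K R c⁻¹ • x) hc
      simpa [smul_smul, ← map_mul, inv_mul_cancel₀ h0] using this
    let f : K →+ M :=
      { toFun := fun c => algebraMap K R c • Ω
        map_zero' := by simp
        map_add' := fun c d => by rw [map_add, add_smul] }
    have hf : Function.Bijective f := by
      refine ⟨(injective_iff_map_eq_zero f).2 hinj, fun x => ?_⟩
      obtain ⟨c, rfl⟩ := huniq x (fun i => i.elim0) (fun i => i.elim0)
      exact ⟨c, rfl⟩
    refine ⟨(AddEquiv.ofBijective f hf).symm, fun c x => ?_⟩
    obtain ⟨d, rfl⟩ := (AddEquiv.ofBijective f hf).surjective x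
    rw [AddEquiv.symm_apply_apply, AddEquiv.symm_apply_eq]
    change algebraMap K R c • algebraMap K R d • Ω = algebraMap K R (c * d) • Ω
    rw [map_mul, mul_smul]
  | succ m ih =>
    have hM := bijective_nsmul K (R := R) (M := M)
    rw [List.ofFn_succ, Fin.sum_univ_succ]
    by_cases hb : b 0
    · -- `r 0` is an annihilator: pass to its kernel
      have h0 : ∀ x, DistribSMul.toAddMonoidHom M (r 0) (s 0 x) =
          s 0 (DistribSMul.toAddMonoidHom M (r 0) x) + x := fun x => by
        simpa [hb] using (h 0 0 x le_rfl).symm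
      let N : Submodule R M := LinearMap.ker (LinearMap.lsmul R M (r 0))
      have hN : ∀ x : M, x ∈ N ↔ r 0 • x = 0 := fun x => by simp [N]
      have hsN : ∀ (i : Fin m) (x : M), x ∈ N → s i.succ x ∈ N := by
        intro i x hx
        rw [hN] at hx ⊢
        have := h 0 i.succ x (Fin.zero_le _)
        simpa [hx, (Fin.succ_ne_zero i).symm] using this.symm
      let s' : Fin m → N →+ N := fun i =>
        ((s i.succ).comp N.subtype.toAddMonoidHom).codRestrict N.toAddSubgroup
          fun x => hsN i x x.2
      have hs' : ∀ i (x : N), ((s' i x : N) : M) = s i.succ x := fun i x => rfl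
      refine .inr ⟨∑ i : Fin m, if b i.succ then 1 else 0, ModuleCat.of R N, N.subtype,
        by simp [hb, add_comm], fun x => ?_, N.injective_subtype, fun x => ?_, ?_⟩
      · obtain ⟨y, hy⟩ := surjective hM h0 (hr 0 hb) x
        exact ⟨y, hy.symm⟩
      · rw [← hN]
        exact ⟨fun ⟨y, hy⟩ => hy ▸ y.2, fun hx => ⟨⟨x, hx⟩, rfl⟩⟩
      · refine ih (ModuleCat.of R N) (fun i => b i.succ) (fun i => r i.succ) s'
          ⟨Ω, (hN Ω).2 (hΩr 0 hb)⟩ ?_ ?_ ?_ ?_ ?_ ?_ ?_ ?_ ?_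
        · intro i j x hij
          have := h i.succ j.succ x.1 (Fin.succ_le_succ_iff.2 hij)
          refine Subtype.ext ?_
          simpa [hs', apply_ite (Subtype.val : N → M)] using this
        · intro i j x hi hj
          exact Subtype.ext (hcomm _ _ _ hi hj)
        · intro i j hi hj
          exact Fin.succ_lt_succ_iff.1 (hmono _ _ hi hj)
        · intro i hi x
          obtain ⟨k, hk⟩ := hr i.succ hi x.1
          refine ⟨k, Subtype.ext ?_⟩
          have : Function.Semiconj (Subtype.val : N → M) (fun y => r i.succ • y)
            (fun y => r i.succ • y) := fun y => rfl
          rw [(this.iterate_right k).eq x]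
          exact hk
        · intro i hi x
          obtain ⟨k, hk⟩ := hs i.succ hi x.1
          refine ⟨k, Subtype.ext ?_⟩
          have : Function.Semiconj (Subtype.val : N → M) (s' i) (s i.succ) := fun y => rfl
          rw [(this.iterate_right k).eq x]
          exact hk
        · exact fun h => hΩ (congrArg Subtype.val h)
        · exact fun i hi => Subtype.ext (hΩr _ hi)
        · exact fun i hi => Subtype.ext (hΩs _ hi)
        · intro x hx1 hx2
          obtain ⟨c, hc⟩ := huniq x.1
            (fun i => Fin.cases (fun _ => (hN _).1 x.2)
              (fun i hi => congrArg Subtype.val (hx1 i hi)) i)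
            (fun i => Fin.cases (fun h => absurd hb h)
              (fun i hi => congrArg Subtype.val (hx2 i hi)) i)
          exact ⟨c, Subtype.ext hc⟩
    · -- `r 0` is a creator, and so are all the others: pass to its cokernel
      have hb' : ∀ i, ¬ b i := fun i hi => by simpa using hmono 0 i hi hb
      have hrel : ∀ i j x, i ≤ j → s j (r i • x) = r i • s j x + if i = j then x else 0 :=
        fun i j x hij => by simpa [hb' i] using h i j x hij
      have h0 : ∀ x, s 0 (DistribSMul.toAddMonoidHom M (r 0) x) =
          DistribSMul.toAddMonoidHom M (r 0) (s 0 x) + x := fun x => by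
        simpa using hrel 0 0 x le_rfl
      have hs0 : ∀ y, s 0 (r 0 • y) = 0 → y = 0 := fun y hy =>
        eq_zero_of_apply_apply hM h0 (hs 0 hb) hy
      have hmk : ∀ x : M, (Submodule.Quotient.mk x : QuotSMulTop (r 0) M) = 0 ↔
          ∃ y, x = r 0 • y := fun x => by
        rw [Submodule.Quotient.mk_eq_zero, mem_smul_top]
      have hd : ∀ i : Fin m, ∃ s' : QuotSMulTop (r 0) M →+ QuotSMulTop (r 0) M, ∀ x,
          s' (Submodule.Quotient.mk x) = Submodule.Quotient.mk (s i.succ x) := by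
        intro i
        refine exists_descend (Submodule.mkQ (r 0 • (⊤ : Submodule R M))).toAddMonoidHom
          (Submodule.mkQ_surjective _) (s i.succ) fun x hx => ?_
        obtain ⟨y, rfl⟩ := (hmk x).1 hx
        exact (hmk _).2 ⟨s i.succ y, by
          rw [hrel _ _ _ (Fin.zero_le _)]; simp [(Fin.succ_ne_zero i).symm]⟩
      choose s' hs' using hd
      -- each class has a representative in the kernel of `s 0`
      have hrep : ∀ z : QuotSMulTop (r 0) M, ∃ x : M, s 0 x = 0 ∧ Submodule.Quotient.mk x = z := by
        intro z
        obtain ⟨x, rfl⟩ := Submodule.Quotient.mk_surjective _ z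
        obtain ⟨a, c, ha, hac⟩ := exists_add hM h0 (hs 0 hb) x
        refine ⟨a, ha, ?_⟩
        rw [← sub_eq_zero, ← Submodule.Quotient.mk_sub, hmk]
        exact ⟨-c, by rw [hac]; simp⟩
      have hker : ∀ x : M, s 0 x = 0 → (Submodule.Quotient.mk x : QuotSMulTop (r 0) M) = 0 →
          x = 0 := by
        intro x hx hx'
        obtain ⟨y, rfl⟩ := (hmk x).1 hx'
        rw [hs0 y hx, smul_zero]
      refine .inl ⟨ModuleCat.of R (QuotSMulTop (r 0) M),
        Submodule.mkQ (r 0 • (⊤ : Submodule R M)), fun x hx => hs0 x (by rw [hx, map_zero]),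
        Submodule.mkQ_surjective _, hmk, ?_⟩
      rw [if_neg hb, zero_add]
      refine ih (ModuleCat.of R (QuotSMulTop (r 0) M)) (fun i => b i.succ) (fun i => r i.succ) s'
        (Submodule.Quotient.mk Ω) ?_ ?_ ?_ ?_ ?_ ?_ ?_ ?_ ?_
      · intro i j x hij
        obtain ⟨x, rfl⟩ := Submodule.Quotient.mk_surjective _ x
        rw [hs', ← Submodule.Quotient.mk_smul, hs', hrel _ _ _ (Fin.succ_le_succ_iff.2 hij)]
        by_cases hij : i = j <;> simp [hij, hb']
      · intro i j x hi hj
        obtain ⟨x, rfl⟩ := Submodule.Quotient.mk_surjective _ x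
        rw [hs', hs', hs', hs', hcomm _ _ _ hi hj]
      · exact fun i j hj => absurd hj (hb' _)
      · exact fun i hi => absurd hi (hb' _)
      · intro i hi x
        obtain ⟨x, rfl⟩ := Submodule.Quotient.mk_surjective _ x
        obtain ⟨k, hk⟩ := hs i.succ hi x
        refine ⟨k, ?_⟩
        have : Function.Semiconj (Submodule.Quotient.mk (p := r 0 • (⊤ : Submodule R M)))
          (s i.succ) (s' i) := fun y => (hs' i y).symm
        rw [← (this.iterate_right k).eq x, hk, Submodule.Quotient.mk_zero]
      · exact fun hΩ' => hΩ (hker Ω (hΩs 0 hb) hΩ')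
      · exact fun i hi => absurd hi (hb' _)
      · intro i hi
        rw [hs', hΩs _ hi, Submodule.Quotient.mk_zero]
      · intro z _ hz
        obtain ⟨x, hx, rfl⟩ := hrep z
        obtain ⟨c, hc⟩ := huniq x (fun i hi => absurd hi (hb' _)) (fun i => Fin.cases
          (fun _ => hx) (fun i hi => hker _ (by rw [hcomm _ _ _ hb (hb' _), hx, map_zero])
            (by rw [← hs']; exact hz i hi)) i)
        exact ⟨c, by rw [hc, Submodule.Quotient.mk_smul]⟩

end Heisenberg

/-! ### Quotients of chain complexes by weakly regular sequences -/

namespace CollapsingHomology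

open CategoryTheory Limits RingTheory.Sequence
open scoped Pointwise

variable {K R : Type*} [Field K] [CommRing R] [Algebra K R]

/-- Multiplication by a ring element, as an endomorphism of a chain complex. -/
noncomputable def smulHom (X : ChainComplex (ModuleCat.{v} R) ℕ) (r : R) : X ⟶ X := r • 𝟙 X

theorem smulHom_f_apply (X : ChainComplex (ModuleCat.{v} R) ℕ) (r : R) (p : ℕ) (x : X.X p) :
    (smulHom X r).f p x = r • x := by
  simp [smulHom]

theorem homologyMap_smulHom_apply (X : ChainComplex (ModuleCat.{v} R) ℕ) (r : R) (p : ℕ)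
    (x : X.homology p) : HomologicalComplex.homologyMap (smulHom X r) p x = r • x := by
  have h : HomologicalComplex.homologyMap (smulHom X r) p = r • 𝟙 _ := by
    have : (HomologicalComplex.shortComplexFunctor (ModuleCat.{v} R) _ p).map (smulHom X r) =
        r • 𝟙 (X.sc p) := by
      ext <;> simp [smulHom] <;> rfl
    rw [HomologicalComplex.homologyMap, this, ShortComplex.homologyMap_smul,
      ShortComplex.homologyMap_id]
    rfl
  rw [h]
  simp

section LongExactSequence

variable {X X' : ChainComplex (ModuleCat.{v} R) ℕ} {r : R} (g : X ⟶ X')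
  (hg : ∀ p, Function.Surjective (g.f p)) (hker : ∀ p x, g.f p x = 0 ↔ ∃ y, x = r • y)
  (hinj : ∀ p (x : X.X p), r • x = 0 → x = 0)

include hker in
theorem smulHom_comp : smulHom X r ≫ g = 0 := by
  ext p x
  simpa [smulHom_f_apply] using (hker p (r • x)).2 ⟨x, rfl⟩

include hg hinj in
theorem shortExact :
    (ShortComplex.mk (smulHom X r) g (smulHom_comp g hker)).ShortExact := by
  rw [HomologicalComplex.shortExact_iff_degreewise_shortExact]
  intro p
  refine { exact := ?_, mono_f := ?_, epi_g := ?_ }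
  · rw [ShortComplex.moduleCat_exact_iff]
    intro x hx
    obtain ⟨y, rfl⟩ := (hker p x).1 hx
    exact ⟨y, smulHom_f_apply X r p y⟩
  · rw [ModuleCat.mono_iff_injective]
    refine (injective_iff_map_eq_zero _).2 fun x hx => hinj p x
      ((smulHom_f_apply X r p x).symm.trans hx)
  · rw [ModuleCat.epi_iff_surjective]
    exact hg p

include hg hker hinj

/-- Exactness of the long exact sequence at the homology of the middle term. -/
theorem homologyMap_eq_zero_iff (p : ℕ) (x : X.homology p) :
    HomologicalComplex.homologyMap g p x = 0 ↔ ∃ y, x = r • y := by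
  have h := (shortExact g hg hker hinj).homology_exact₂ p
  rw [ShortComplex.moduleCat_exact_iff] at h
  constructor
  · intro hx
    obtain ⟨y, hy⟩ := h x hx
    exact ⟨y, by rw [← homologyMap_smulHom_apply]; exact hy.symm⟩
  · rintro ⟨y, rfl⟩
    rw [← homologyMap_smulHom_apply, ← ConcreteCategory.comp_apply,
      ← HomologicalComplex.homologyMap_comp, smulHom_comp g hker,
      HomologicalComplex.homologyMap_zero]
    rfl

theorem homologyMap_zero_surjective :
    Function.Surjective (HomologicalComplex.homologyMap g 0) := by
  rw [← ModuleCat.epi_iff_surjective]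
  have := (shortExact g hg hker hinj).epi_g
  exact HomologicalComplex.epi_homologyMap_of_epi_of_not_rel g 0 (by simp)

/-- The connecting map, with exactness at its source and at its target. -/
theorem exists_connecting (p : ℕ) : ∃ δ : X'.homology (p + 1) →ₗ[R] X.homology p,
    (∀ z, δ z = 0 ↔ ∃ x, z = HomologicalComplex.homologyMap g (p + 1) x) ∧
      ∀ y, r • y = 0 ↔ ∃ z, y = δ z := by
  have hS := shortExact g hg hker hinj
  have hij : (ComplexShape.down ℕ).Rel (p + 1) p := rfl
  have h1 := hS.homology_exact₁ (p + 1) p hij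
  have h3 := hS.homology_exact₃ (p + 1) p hij
  rw [ShortComplex.moduleCat_exact_iff] at h1 h3
  refine ⟨(hS.δ (p + 1) p hij).hom, fun z => ⟨fun hz => ?_, ?_⟩, fun y => ⟨fun hy => ?_, ?_⟩⟩
  · obtain ⟨x, hx⟩ := h3 z hz
    exact ⟨x, hx.symm⟩
  · rintro ⟨x, rfl⟩
    exact ConcreteCategory.congr_hom (hS.comp_δ (p + 1) p hij) x
  · obtain ⟨z, hz⟩ := h1 y (by rw [← hy]; exact homologyMap_smulHom_apply X r p y)
    exact ⟨z, hz.symm⟩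
  · rintro ⟨z, rfl⟩
    rw [← homologyMap_smulHom_apply]
    exact ConcreteCategory.congr_hom (hS.δ_comp (p + 1) p hij) z

end LongExactSequence

/-- The quotient complex `X / r X` and its universal property, for an `r` that acts injectively. -/
theorem exists_quotient (X : ChainComplex (ModuleCat.{v} R) ℕ) (r : R)
    (hinj : ∀ p (x : X.X p), r • x = 0 → x = 0) :
    ∃ (X' : ChainComplex (ModuleCat.{v} R) ℕ) (g : X ⟶ X'), (∀ p, Function.Surjective (g.f p)) ∧
      (∀ p x, g.f p x = 0 ↔ ∃ y, x = r • y) ∧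
      ∀ (Y : ChainComplex (ModuleCat.{v} R) ℕ) (f : X ⟶ Y),
        (∀ p x, f.f p (r • x) = 0) → ∃ f' : X' ⟶ Y, g ≫ f' = f := by
  have : Mono (smulHom X r) := HomologicalComplex.mono_of_mono_f _ fun p => by
    rw [ModuleCat.mono_iff_injective]
    exact (injective_iff_map_eq_zero _).2 fun x hx =>
      hinj p x (by rw [← smulHom_f_apply]; exact hx)
  have hS : (ShortComplex.mk (smulHom X r) _ (cokernel.condition (smulHom X r))).ShortExact :=
    { exact := ShortComplex.exact_cokernel _ }
  rw [HomologicalComplex.shortExact_iff_degreewise_shortExact] at hS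
  refine ⟨cokernel (smulHom X r), cokernel.π _, fun p => ?_, fun p x => ⟨fun hx => ?_, ?_⟩,
    fun Y f hf => ⟨cokernel.desc _ f ?_, cokernel.π_desc _ _ _⟩⟩
  · exact (ModuleCat.epi_iff_surjective _).1 (hS p).epi_g
  · obtain ⟨y, hy⟩ := (ShortComplex.moduleCat_exact_iff _).1 (hS p).exact x hx
    exact ⟨y, hy.symm.trans (smulHom_f_apply X r p y)⟩
  · rintro ⟨y, rfl⟩
    rw [← smulHom_f_apply, ← ConcreteCategory.comp_apply, ← HomologicalComplex.comp_f,
      cokernel.condition]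
    rfl
  · ext p x
    simpa [smulHom_f_apply] using hf p x

/-- If multiplication by a weakly regular sequence collapses the homology of `X`, which is
concentrated in degree `s`, then the quotient `Y` of `X` by the sequence has one-dimensional
homology, concentrated in degree `s + d`: the long exact sequence of `0 → X → X → X / r X → 0`
replaces the homology of `X` by the cokernel of `r`, or by the kernel of `r` one degree higher. -/
theorem homology_of_collapses (rs : List R) {X Y : ChainComplex (ModuleCat.{v} R) ℕ} (f : X ⟶ Y)
    (s d : ℕ) (hreg : ∀ p, IsWeaklyRegular (X.X p) rs) (hf : ∀ p, Function.Surjective (f.f p))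
    (hker : ∀ p, LinearMap.ker (f.f p).hom = Ideal.ofList rs • ⊤)
    (h0 : ∀ p, p ≠ s → Subsingleton (X.homology p)) (hs : Collapses K rs d (X.homology s)) :
    (∀ p, p ≠ s + d → Subsingleton (Y.homology p)) ∧
      Collapses K ([] : List R) 0 (Y.homology (s + d)) := by
  induction rs generalizing X s d with
  | nil =>
    obtain rfl : d = 0 := hs.1
    have hiso : ∀ p, IsIso (f.f p) := fun p => by
      rw [ConcreteCategory.isIso_iff_bijective]
      refine ⟨(injective_iff_map_eq_zero _).2 fun x hx => ?_, hf p⟩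
      have : x ∈ LinearMap.ker (f.f p).hom := hx
      simpa [hker] using this
    have : IsIso f := HomologicalComplex.Hom.isIso_of_components f
    let e : ∀ p, X.homology p ≃ₗ[R] Y.homology p := fun p =>
      (asIso (HomologicalComplex.homologyMap f p)).toLinearEquiv
    exact ⟨fun p hp => have := h0 p hp; (e p).symm.toEquiv.subsingleton, hs.congr (e s)⟩
  | cons r rs ih =>
    have hinj : ∀ p (x : X.X p), r • x = 0 → x = 0 := fun p x =>
      isSMulRegular_iff_right_eq_zero_of_smul.1
        ((isWeaklyRegular_cons_iff _ r rs).1 (hreg p)).1 x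
    obtain ⟨X', g, hg, hgker, hdesc⟩ := exists_quotient X r hinj
    obtain ⟨f', rfl⟩ := hdesc Y f fun p x => by
      have : r • x ∈ LinearMap.ker (f.f p).hom := by
        rw [hker, Ideal.ofList_cons_smul]
        exact Submodule.mem_sup_left (Submodule.smul_mem_pointwise_smul _ _ _ trivial)
      exact this
    have hgker' : ∀ p, LinearMap.ker (g.f p).hom = r • ⊤ := fun p => by
      ext x
      rw [Heisenberg.mem_smul_top, ← hgker]
      rfl
    have hgtop : ∀ p, Submodule.map (g.f p).hom ⊤ = ⊤ := fun p => by
      rw [Submodule.map_top, LinearMap.range_eq_top]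
      exact hg p
    have hreg' : ∀ p, IsWeaklyRegular (X'.X p) rs := fun p =>
      (((Submodule.quotEquivOfEq _ _ (hgker' p).symm) ≪≫ₗ
        (g.f p).hom.quotKerEquivOfSurjective (hg p)).isWeaklyRegular_congr rs).1
        ((isWeaklyRegular_cons_iff _ r rs).1 (hreg p)).2
    have hf' : ∀ p, Function.Surjective (f'.f p) := fun p y => by
      obtain ⟨x, hx⟩ := hf p y
      exact ⟨g.f p x, hx⟩
    have hker' : ∀ p, LinearMap.ker (f'.f p).hom = Ideal.ofList rs • ⊤ := fun p => by
      have := hker p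
      rw [HomologicalComplex.comp_f, ModuleCat.hom_comp, LinearMap.ker_comp] at this
      rw [← Submodule.map_comap_eq_of_surjective (hg p) (LinearMap.ker (f'.f p).hom)]
      erw [this]
      rw [Ideal.ofList_cons_smul, Submodule.map_sup, Submodule.map_smul'', hgtop, ← hgker',
        (LinearMap.le_ker_iff_map (f := (g.f p).hom)).1 le_rfl, bot_sup_eq]
    have hz := homologyMap_eq_zero_iff g hg hgker hinj
    have hz0 := homologyMap_zero_surjective g hg hgker hinj
    have hδ := exists_connecting g hg hgker hinj
    -- the homology of `X'` vanishes wherever that of `X` does in this degree and in the one below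
    have hvan : ∀ p, Subsingleton (X.homology p) →
        (∀ q, p = q + 1 → ∀ y : X.homology q, r • y = 0 → y = 0) →
        Subsingleton (X'.homology p) := by
      intro p hp hq
      refine subsingleton_of_forall_eq 0 fun z => ?_
      have hzero : (∃ x, z = HomologicalComplex.homologyMap g p x) → z = 0 := by
        rintro ⟨x, rfl⟩
        rw [Subsingleton.elim x 0, map_zero]
      rcases p with - | q
      · obtain ⟨x, hx⟩ := hz0 z
        exact hzero ⟨x, hx.symm⟩
      · obtain ⟨δ, h1, h2⟩ := hδ q
        exact hzero ((h1 z).1 (hq q rfl _ ((h2 _).2 ⟨z, rfl⟩)))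
    rcases hs with ⟨N, φ, hr, hφ, hφker, hN⟩ | ⟨d', N, φ, rfl, hr, hφ, hφker, hN⟩
    · refine ih f' s d hreg' hf' hker' (fun p hp => hvan p (h0 p hp) fun q hq y hy => ?_) ?_
      · by_cases hqs : q = s
        · subst hqs
          exact hr y hy
        · have := h0 q hqs
          exact Subsingleton.elim _ _
      · have hsurj : Function.Surjective (HomologicalComplex.homologyMap g s) := by
          rcases s with - | q
          · exact hz0
          · intro z
            obtain ⟨δ, h1, h2⟩ := hδ q
            have := h0 q (by omega)
            obtain ⟨x, hx⟩ := (h1 z).1 (Subsingleton.elim _ _)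
            exact ⟨x, hx.symm⟩
        have hk : LinearMap.ker φ =
            LinearMap.ker (HomologicalComplex.homologyMap g s).hom := by
          ext x
          rw [LinearMap.mem_ker, hφker, LinearMap.mem_ker]
          exact (hz s x).symm
        exact hN.congr ((φ.quotKerEquivOfSurjective hφ).symm ≪≫ₗ Submodule.quotEquivOfEq _ _ hk ≪≫ₗ
          (HomologicalComplex.homologyMap g s).hom.quotKerEquivOfSurjective hsurj)
    · have hrw : s + (d' + 1) = s + 1 + d' := by omega
      rw [hrw]
      refine ih f' (s + 1) d' hreg' hf' hker' (fun p hp => ?_) ?_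
      · by_cases hps : p = s
        · subst hps
          refine subsingleton_of_forall_eq 0 fun z => ?_
          have hzero : (∃ x, z = HomologicalComplex.homologyMap g p x) → z = 0 := by
            rintro ⟨x, rfl⟩
            exact (hz p x).2 (hr x)
          rcases p with - | q
          · obtain ⟨x, hx⟩ := hz0 z
            exact hzero ⟨x, hx.symm⟩
          · obtain ⟨δ, h1, h2⟩ := hδ q
            have := h0 q (by omega)
            exact hzero ((h1 z).1 (Subsingleton.elim _ _))
        · refine hvan p (h0 p hps) fun q hq y _ => ?_
          have := h0 q (by omega)
          exact Subsingleton.elim _ _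
      · obtain ⟨δ, h1, h2⟩ := hδ s
        have := h0 (s + 1) (by omega)
        have hδinj : Function.Injective δ := (injective_iff_map_eq_zero δ).2 fun z hz' => by
          obtain ⟨x, rfl⟩ := (h1 z).1 hz'
          rw [Subsingleton.elim x 0, map_zero]
        have hrange : LinearMap.range φ = LinearMap.range δ := by
          ext y
          simp only [LinearMap.mem_range]
          simpa [eq_comm] using (hφker y).trans (h2 y)
        exact hN.congr (LinearEquiv.ofInjective φ hφ ≪≫ₗ LinearEquiv.ofEq _ _ hrange ≪≫ₗ
          (LinearEquiv.ofInjective δ hδinj).symm)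

end CollapsingHomology

/-! ### The bar resolution -/

namespace Bar

universe u

variable (K : Type u) [CommRing K] (A : Type u) [Ring A] [Algebra K A]

/-- The tensor power `A^{⊗n}` over `K`. -/
abbrev Tens (n : ℕ) : Type u := ⨂[K] _ : Fin n, A

variable {A}

/-- The isomorphism `A^{⊗n} ⊗ A ≃ A^{⊗(n+1)}`. -/
noncomputable def snoc (n : ℕ) : Tens K A n ⊗[K] A ≃ₗ[K] Tens K A (n + 1) :=
  TensorProduct.congr (LinearEquiv.refl K _)
      (PiTensorProduct.subsingletonEquiv (R := K) (s := fun _ : Fin 1 => A) (0 : Fin 1)).symm ≪≫ₗ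
    PiTensorProduct.tmulEquiv K A ≪≫ₗ PiTensorProduct.reindex K (fun _ => A) finSumFinEquiv

theorem snoc_tprod (n : ℕ) (a : Fin n → A) (x : A) :
    snoc K n (PiTensorProduct.tprod K a ⊗ₜ x) =
      PiTensorProduct.tprod K (Fin.snoc a x : Fin (n + 1) → A) := by
  rw [snoc, LinearEquiv.trans_apply, LinearEquiv.trans_apply, TensorProduct.congr_tmul,
    PiTensorProduct.subsingletonEquiv_symm_apply', LinearEquiv.refl_apply,
    PiTensorProduct.tmulEquiv_apply, PiTensorProduct.reindex_tprod]
  congr 1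
  funext i
  refine Fin.lastCases ?_ (fun j => ?_) i
  · simp
  · simp

theorem tprod_eq_snoc (n : ℕ) (a : Fin (n + 1) → A) : PiTensorProduct.tprod K a =
    snoc K n (PiTensorProduct.tprod K (Fin.init a : Fin n → A) ⊗ₜ a (Fin.last n)) := by
  rw [snoc_tprod, Fin.snoc_init_self]

variable {K}

theorem ext_snoc {M : Type*} [AddCommGroup M] [Module K M] {n : ℕ}
    {f g : Tens K A (n + 1) →ₗ[K] M}
    (h : ∀ t x, f (snoc K n (t ⊗ₜ x)) = g (snoc K n (t ⊗ₜ x))) : f = g := by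
  have : f ∘ₗ (snoc K n).toLinearMap = g ∘ₗ (snoc K n).toLinearMap :=
    TensorProduct.ext' fun t x => h t x
  refine LinearMap.ext fun y => ?_
  obtain ⟨z, rfl⟩ := (snoc K n).surjective y
  exact LinearMap.congr_fun this z

variable (K)

/-- Multiplication into the last factor, `(a₀, …, aₙ) ⊗ x ↦ (a₀, …, aₙ x)`. -/
noncomputable def mulLast (n : ℕ) : Tens K A (n + 1) ⊗[K] A →ₗ[K] Tens K A (n + 1) :=
  (snoc K n).toLinearMap ∘ₗ LinearMap.lTensor (Tens K A n) (LinearMap.mul' K A) ∘ₗ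
    (TensorProduct.assoc K _ A A).toLinearMap ∘ₗ LinearMap.rTensor A (snoc K n).symm.toLinearMap

theorem mulLast_snoc (n : ℕ) (t : Tens K A n) (x y : A) :
    mulLast K n (snoc K n (t ⊗ₜ x) ⊗ₜ y) = snoc K n (t ⊗ₜ (x * y)) := by
  simp [mulLast]

/-- Right multiplication by `x` on the last factor. -/
noncomputable def rmul (n : ℕ) (x : A) : Module.End K (Tens K A (n + 1)) :=
  mulLast K n ∘ₗ (TensorProduct.mk K (Tens K A (n + 1)) A).flip x

theorem rmul_apply (n : ℕ) (x : A) (t : Tens K A (n + 1)) :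
    rmul K n x t = mulLast K n (t ⊗ₜ x) := rfl

theorem rmul_snoc (n : ℕ) (t : Tens K A n) (x y : A) :
    rmul K n y (snoc K n (t ⊗ₜ x)) = snoc K n (t ⊗ₜ (x * y)) := mulLast_snoc K n t x y

theorem rmul_one (n : ℕ) : rmul K n (1 : A) = 1 := ext_snoc fun t x => by simp [rmul_snoc]

theorem rmul_mul (n : ℕ) (x y : A) : rmul K n (x * y) = rmul K n y * rmul K n x :=
  ext_snoc fun t z => by simp [rmul_snoc, mul_assoc]

/-- The operator `f` applied to the first factor. -/
noncomputable def head (n : ℕ) : Module.End K A →ₗ[K] Module.End K (Tens K A (n + 1)) where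
  toFun f := PiTensorProduct.map (Function.update (fun _ => LinearMap.id) 0 f)
  map_add' _ _ := PiTensorProduct.map_update_add _ _ _ _
  map_smul' _ _ := PiTensorProduct.map_update_smul _ _ _ _

theorem head_tprod (n : ℕ) (f : Module.End K A) (a : Fin (n + 1) → A) :
    head K n f (PiTensorProduct.tprod K a) =
      PiTensorProduct.tprod K (Function.update a 0 (f (a 0))) := by
  simp only [head, LinearMap.coe_mk, AddHom.coe_mk, PiTensorProduct.map_tprod]
  congr 1
  funext i
  by_cases hi : i = 0
  · subst hi
    simp
  · simp [hi]

theorem head_mul (n : ℕ) (f g : Module.End K A) : head K n (f * g) = head K n f * head K n g := by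
  refine PiTensorProduct.ext (MultilinearMap.ext fun a => ?_)
  simp [head_tprod]

theorem head_one (n : ℕ) : head K n (1 : Module.End K A) = 1 := by
  refine PiTensorProduct.ext (MultilinearMap.ext fun a => ?_)
  simp [head_tprod]

theorem head_zero_snoc (f : Module.End K A) (t : Tens K A 0) (x : A) :
    head K 0 f (snoc K 0 (t ⊗ₜ x)) = snoc K 0 (t ⊗ₜ f x) := by
  induction t using PiTensorProduct.induction_on with
  | smul_tprod c a =>
    simp only [← TensorProduct.smul_tmul', map_smul, snoc_tprod, head_tprod]
    congr 2
    funext i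
    obtain rfl : i = 0 := Fin.fin_one_eq_zero i
    simp [Fin.snoc]
  | add a b ha hb => simp only [TensorProduct.add_tmul, map_add, ha, hb]

theorem head_succ_snoc (n : ℕ) (f : Module.End K A) (t : Tens K A (n + 1)) (x : A) :
    head K (n + 1) f (snoc K (n + 1) (t ⊗ₜ x)) = snoc K (n + 1) (head K n f t ⊗ₜ x) := by
  induction t using PiTensorProduct.induction_on with
  | smul_tprod c a =>
    have h0 : (Fin.snoc a x : Fin (n + 2) → A) 0 = a 0 := by
      rw [← Fin.castSucc_zero, Fin.snoc_castSucc]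
    simp only [← TensorProduct.smul_tmul', map_smul, snoc_tprod, head_tprod, h0]
    congr 2
    funext i
    refine Fin.lastCases ?_ (fun j => ?_) i
    · simp [Fin.ext_iff]
    · by_cases hj : j = 0
      · subst hj
        rw [Fin.snoc_castSucc, Fin.castSucc_zero, Function.update_self, Function.update_self]
      · have : j.castSucc ≠ 0 := fun h => hj (Fin.ext (by simpa using congrArg Fin.val h))
        simp [Function.update_of_ne, hj, this]
  | add a b ha hb => simp only [TensorProduct.add_tmul, map_add, ha, hb]

theorem head_rmul (n : ℕ) (c x : A) : Commute (head K n (LinearMap.mulLeft K c)) (rmul K n x) := by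
  refine ext_snoc fun t y => ?_
  rcases n with - | n
  · simp [rmul_snoc, head_zero_snoc, mul_assoc]
  · simp [rmul_snoc, head_succ_snoc]

/-- The differential of the bar resolution, `∑ᵢ (-1)ⁱ (a₀, …, aᵢ aᵢ₊₁, …, aₙ)`, the sum running
over `0 ≤ i < n`. It is defined by recursion, splitting off the last factor; `d_tprod` gives the
formula. The term `A^{⊗(p+2)}` is in degree `p`, and `A^{⊗2} → A^{⊗1} = A` is the augmentation. -/
noncomputable def d : ∀ n : ℕ, Tens K A (n + 1) →ₗ[K] Tens K A n
  | 0 => 0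
  | n + 1 => (snoc K n).toLinearMap ∘ₗ LinearMap.rTensor A (d n) ∘ₗ
        (snoc K (n + 1)).symm.toLinearMap +
      (-1 : K) ^ n • mulLast K n ∘ₗ (snoc K (n + 1)).symm.toLinearMap

theorem d_succ_snoc (n : ℕ) (t : Tens K A (n + 1)) (x : A) :
    d K (n + 1) (snoc K (n + 1) (t ⊗ₜ x)) =
      snoc K n (d K n t ⊗ₜ x) + (-1 : K) ^ n • mulLast K n (t ⊗ₜ x) := by
  simp [d]

theorem d_rmul (n : ℕ) (x : A) (t : Tens K A (n + 2)) :
    d K (n + 1) (rmul K (n + 1) x t) = rmul K n x (d K (n + 1) t) := by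
  suffices h : d K (n + 1) ∘ₗ rmul K (n + 1) x = rmul K n x ∘ₗ d K (n + 1) from
    LinearMap.congr_fun h t
  refine ext_snoc fun t y => ?_
  simp only [LinearMap.comp_apply, rmul_snoc, d_succ_snoc, map_add, map_smul]
  congr 2
  exact LinearMap.congr_fun (rmul_mul K n y x) t

theorem d_head (n : ℕ) (c : A) (t : Tens K A (n + 2)) :
    d K (n + 1) (head K (n + 1) (LinearMap.mulLeft K c) t) =
      head K n (LinearMap.mulLeft K c) (d K (n + 1) t) := by
  suffices h : d K (n + 1) ∘ₗ head K (n + 1) (LinearMap.mulLeft K c) =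
      head K n (LinearMap.mulLeft K c) ∘ₗ d K (n + 1) from LinearMap.congr_fun h t
  clear t
  induction n with
  | zero =>
    refine ext_snoc fun t y => ?_
    have h0 : ∀ t : Tens K A 1, d K 0 t = 0 := fun t => rfl
    simp only [LinearMap.comp_apply, head_succ_snoc, d_succ_snoc, map_add, map_smul, h0,
      TensorProduct.zero_tmul, map_zero]
    congr 2
    exact (LinearMap.congr_fun (head_rmul K 0 c y) t).symm
  | succ n ih =>
    refine ext_snoc fun t y => ?_
    have ih' := LinearMap.congr_fun ih t
    simp only [LinearMap.comp_apply] at ih'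
    rw [LinearMap.comp_apply, LinearMap.comp_apply, head_succ_snoc, d_succ_snoc, ih',
      d_succ_snoc, map_add, map_smul, head_succ_snoc]
    congr 2
    exact (LinearMap.congr_fun (head_rmul K (n + 1) c y) t).symm

theorem d_d (n : ℕ) (t : Tens K A (n + 2)) : d K n (d K (n + 1) t) = 0 := by
  suffices h : d K n ∘ₗ d K (n + 1) = 0 from LinearMap.congr_fun h t
  clear t
  induction n with
  | zero => simp [d]
  | succ n ih =>
    refine ext_snoc fun t y => ?_
    have ih' := LinearMap.congr_fun ih t
    simp only [LinearMap.comp_apply] at ih'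
    simp only [LinearMap.comp_apply, d_succ_snoc, map_add, map_smul, ih', ← rmul_apply, d_rmul]
    simp [pow_succ]

/-- Appending a factor `1` is a contracting homotopy of the bar resolution. -/
theorem d_snoc_one (n : ℕ) (t : Tens K A (n + 1)) :
    d K (n + 1) (snoc K (n + 1) (t ⊗ₜ 1)) =
      snoc K n (d K n t ⊗ₜ 1) + (-1 : K) ^ n • t := by
  rw [d_succ_snoc, ← rmul_apply, rmul_one]
  rfl

/-- The bar resolution is exact, also at its augmentation `A ⊗ A → A → 0`. -/
theorem exists_of_d_eq_zero (n : ℕ) (t : Tens K A (n + 1)) (ht : d K n t = 0) :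
    ∃ z, d K (n + 1) z = t := by
  refine ⟨(-1 : K) ^ n • snoc K (n + 1) (t ⊗ₜ 1), ?_⟩
  rw [map_smul, d_snoc_one, ht, TensorProduct.zero_tmul, map_zero, zero_add, smul_smul,
    ← mul_pow]
  simp

theorem mulLast_tprod (n : ℕ) (a : Fin (n + 1) → A) (x : A) :
    mulLast K n (PiTensorProduct.tprod K a ⊗ₜ x) =
      PiTensorProduct.tprod K (Fin.snoc (Fin.init a) (a (Fin.last n) * x) : Fin (n + 1) → A) := by
  rw [tprod_eq_snoc, mulLast_snoc, snoc_tprod]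

theorem d_tprod (n : ℕ) (a : Fin (n + 1) → A) : d K n (PiTensorProduct.tprod K a) =
    ∑ i : Fin n, (-1 : K) ^ (i : ℕ) •
      PiTensorProduct.tprod K (Fin.contractNth i.castSucc (fun x y => x * y) a) := by
  induction n with
  | zero => simp [d]
  | succ n ih =>
    rw [tprod_eq_snoc, d_succ_snoc, ih, Fin.sum_univ_castSucc, TensorProduct.sum_tmul, map_sum]
    congr 1
    · refine Finset.sum_congr rfl fun i _ => ?_
      rw [← TensorProduct.smul_tmul', map_smul, snoc_tprod]
      congr 2
      funext j
      refine Fin.lastCases ?_ (fun j => ?_) j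
      · have h1 : ¬ (n < (i : ℕ)) := by omega
        have h2 : ¬ (n = (i : ℕ)) := by omega
        simp [Fin.contractNth, h1, h2]
      · simp [Fin.contractNth, Fin.init]
    · rw [mulLast_tprod]
      congr 2
      funext j
      refine Fin.lastCases ?_ (fun j => ?_) j
      · simp [Fin.contractNth, Fin.init]
      · simp [Fin.contractNth, Fin.init]

variable {K}

/-- The projection `(b, a₁, …, aₚ) ⊗ a ↦ (a γ(b), a₁, …, aₚ)` of the bar resolution onto the
twisted Hochschild complex. -/
noncomputable def proj (γ : A ≃ₐ[K] A) (p : ℕ) : Tens K A (p + 2) →ₗ[K] Tens K A (p + 1) :=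
  TensorProduct.lift
      (head K p ∘ₗ LinearMap.lcomp K A γ.toLinearMap ∘ₗ LinearMap.mul K A).flip ∘ₗ
    (snoc K (p + 1)).symm.toLinearMap

theorem proj_snoc (γ : A ≃ₐ[K] A) (p : ℕ) (t : Tens K A (p + 1)) (x : A) :
    proj γ p (snoc K (p + 1) (t ⊗ₜ x)) =
      head K p (LinearMap.mulLeft K x) (head K p γ.toLinearMap t) := by
  have : head K p (LinearMap.mulLeft K x * γ.toLinearMap) =
    head K p (LinearMap.mulLeft K x) * head K p γ.toLinearMap := head_mul K p _ _
  rw [← Module.End.mul_apply, ← this]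
  simp [proj]
  rfl

theorem proj_tprod (γ : A ≃ₐ[K] A) (p : ℕ) (a : Fin (p + 1) → A) (x : A) :
    proj γ p (snoc K (p + 1) (PiTensorProduct.tprod K a ⊗ₜ x)) =
      PiTensorProduct.tprod K (Function.update a 0 (x * γ (a 0))) := by
  rw [proj_snoc, head_tprod, head_tprod]
  simp

theorem proj_d (γ : A ≃ₐ[K] A) (p : ℕ) (t : Tens K A (p + 3)) :
    proj γ p (d K (p + 2) t) = Hochschild.boundary K γ p (proj γ (p + 1) t) := by
  suffices h : proj γ p ∘ₗ d K (p + 2) = Hochschild.boundary K γ p ∘ₗ proj γ (p + 1) from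
    LinearMap.congr_fun h t
  refine ext_snoc fun t x => ?_
  induction t using PiTensorProduct.induction_on with
  | smul_tprod c a =>
    simp only [← TensorProduct.smul_tmul', map_smul]
    congr 1
    simp only [LinearMap.comp_apply]
    rw [Hochschild.boundary, LinearMap.sum_apply, Fin.sum_univ_castSucc, proj_tprod, d_succ_snoc,
      map_add, map_smul, proj_snoc, d_tprod, mulLast_tprod, ← snoc_tprod, proj_tprod]
    simp only [map_sum, map_smul, head_tprod, LinearMap.smul_apply, Hochschild.faceMap_tprod]
    congr 1
    · refine Finset.sum_congr rfl fun i _ => ?_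
      congr 2
      funext j
      by_cases hi : i = 0
      · subst hi
        by_cases hj : j = 0
        · subst hj
          simp [Hochschild.face, Fin.contractNth, Fin.ext_iff, mul_assoc]
        · have hj' : ¬ ((j : ℕ) = 0) := fun h => hj (Fin.ext h)
          simp [Hochschild.face, Fin.contractNth, Fin.ext_iff, hj']
      · have hi' : ¬ ((i : ℕ) = 0) := fun h => hi (Fin.ext h)
        have hi2 : ¬ ((i : ℕ) = p + 1) := by omega
        by_cases hj : j = 0
        · subst hj
          have h0 : 0 < (i : ℕ) := by omega
          simp [Hochschild.face, Fin.contractNth, Fin.ext_iff, hi', hi2, h0]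
        · have hj' : ¬ ((j : ℕ) = 0) := fun h => hj (Fin.ext h)
          simp [Hochschild.face, Fin.contractNth, Fin.ext_iff, hi', hi2, hj']
    · congr 2
      funext j
      by_cases hj : j = 0
      · subst hj
        simp [Hochschild.face, Fin.init, Fin.ext_iff, mul_assoc]
      · have hj' : ¬ ((j : ℕ) = 0) := fun h => hj (Fin.ext h)
        simp [Hochschild.face, Fin.init, Fin.ext_iff, hj']
  | add a b ha hb => simp only [TensorProduct.add_tmul, map_add, ha, hb]

theorem head_toLinearMap_bijective (γ : A ≃ₐ[K] A) (p : ℕ) :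
    Function.Bijective (head K p γ.toLinearMap) := by
  have h : ∀ δ ε : A ≃ₐ[K] A, δ.toLinearMap * ε.toLinearMap = 1 →
      ∀ t, head K p δ.toLinearMap (head K p ε.toLinearMap t) = t := fun δ ε h t => by
    rw [← Module.End.mul_apply, ← head_mul, h, head_one]
    rfl
  exact Function.bijective_iff_has_inverse.2 ⟨head K p γ.symm.toLinearMap,
    h _ _ (by ext; simp), h _ _ (by ext; simp)⟩

theorem proj_snoc_one (γ : A ≃ₐ[K] A) (p : ℕ) (t : Tens K A (p + 1)) :
    proj γ p (snoc K (p + 1) (t ⊗ₜ 1)) = head K p γ.toLinearMap t := by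
  rw [proj_snoc]
  have : LinearMap.mulLeft K (1 : A) = 1 := LinearMap.ext fun x => one_mul x
  rw [this, head_one]
  rfl

theorem proj_surjective (γ : A ≃ₐ[K] A) (p : ℕ) : Function.Surjective (proj γ p) := by
  intro y
  obtain ⟨t, rfl⟩ := (head_toLinearMap_bijective γ p).2 y
  exact ⟨_, proj_snoc_one γ p t⟩

/-- The operator `a₀ ⊗ ⋯ ⊗ aₙ ↦ a₀ ⊗ ⋯ ⊗ aₙ x - γ⁻¹(x) a₀ ⊗ ⋯ ⊗ aₙ`. -/
noncomputable def twistedComm (γ : A ≃ₐ[K] A) (n : ℕ) (x : A) : Module.End K (Tens K A (n + 1)) :=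
  rmul K n x - head K n (LinearMap.mulLeft K (γ.symm x))

theorem twistedComm_apply (γ : A ≃ₐ[K] A) (n : ℕ) (x : A) (t : Tens K A (n + 1)) :
    twistedComm γ n x t = rmul K n x t - head K n (LinearMap.mulLeft K (γ.symm x)) t := rfl

theorem d_twistedComm (γ : A ≃ₐ[K] A) (n : ℕ) (x : A) (t : Tens K A (n + 2)) :
    d K (n + 1) (twistedComm γ (n + 1) x t) = twistedComm γ n x (d K (n + 1) t) := by
  simp only [twistedComm_apply, map_sub, d_rmul, d_head]

theorem proj_twistedComm (γ : A ≃ₐ[K] A) (p : ℕ) (x : A) (t : Tens K A (p + 2)) :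
    proj γ p (twistedComm γ (p + 1) x t) = 0 := by
  suffices h : proj γ p ∘ₗ twistedComm γ (p + 1) x = 0 from LinearMap.congr_fun h t
  refine ext_snoc fun t y => ?_
  simp only [LinearMap.comp_apply, twistedComm_apply, rmul_snoc, head_succ_snoc, map_sub,
    proj_snoc, LinearMap.zero_apply, sub_eq_zero]
  simp only [← Module.End.mul_apply, ← head_mul]
  congr 2
  ext z
  simp

/-- Elements with a scalar commutator give commuting operators, since `γ` fixes scalars. -/
theorem twistedComm_commute (γ : A ≃ₐ[K] A) (n : ℕ) (x y : A) (k : K)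
    (h : x * y - y * x = algebraMap K A k) : Commute (twistedComm γ n x) (twistedComm γ n y) := by
  have hγ : γ.symm x * γ.symm y - γ.symm y * γ.symm x = algebraMap K A k := by
    rw [← map_mul, ← map_mul, ← map_sub, h, AlgEquiv.commutes]
  have e1 : rmul K n (x * y) = rmul K n (y * x) + k • 1 := by
    rw [← sub_eq_iff_eq_add']
    refine ext_snoc fun t z => ?_
    simp only [LinearMap.sub_apply, rmul_snoc, ← map_sub, ← TensorProduct.tmul_sub, ← mul_sub, h,
      Algebra.algebraMap_eq_smul_one]
    simp
  have e2 : head K n (LinearMap.mulLeft K (γ.symm x) * LinearMap.mulLeft K (γ.symm y)) =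
      head K n (LinearMap.mulLeft K (γ.symm y) * LinearMap.mulLeft K (γ.symm x)) + k • 1 := by
    rw [← sub_eq_iff_eq_add', ← map_sub, ← head_one K n, ← map_smul]
    congr 1
    ext z
    simp only [LinearMap.sub_apply, Module.End.mul_apply, LinearMap.mulLeft_apply, ← mul_assoc,
      ← sub_mul, hγ]
    simp [Algebra.algebraMap_eq_smul_one]
  have c1 := (head_rmul K n (γ.symm x) y).eq
  have c2 := (head_rmul K n (γ.symm y) x).eq
  rw [rmul_mul, rmul_mul] at e1
  rw [head_mul, head_mul] at e2
  rw [Commute, SemiconjBy, twistedComm, twistedComm, sub_mul, mul_sub, mul_sub, sub_mul, mul_sub,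
    mul_sub, c1, c2, e1, e2]
  abel

end Bar

/-! ### Complexes with an action of commuting operators -/

namespace CommOperators

open CategoryTheory MvPolynomial

universe u

section Lift

variable {K ι S : Type*} [CommRing K] [Ring S] [Algebra K S]

/-- The evaluation of polynomials at a family of commuting elements of an algebra. -/
noncomputable def commLift (f : ι → S) (h : ∀ i j, Commute (f i) (f j)) :
    MvPolynomial ι K →ₐ[K] S :=
  letI : CommRing (Algebra.adjoin K (Set.range f)) :=
    { (inferInstance : Ring (Algebra.adjoin K (Set.range f))) with
      mul_comm := (Algebra.isMulCommutative_adjoin K (s := Set.range f) (by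
        rintro _ ⟨i, rfl⟩ _ ⟨j, rfl⟩
        exact h i j)).is_comm.comm }
  (Algebra.adjoin K (Set.range f)).val.comp
    (aeval (S₁ := Algebra.adjoin K (Set.range f))
      fun i => ⟨f i, Algebra.subset_adjoin ⟨i, rfl⟩⟩)

theorem commLift_X (f : ι → S) (h : ∀ i j, Commute (f i) (f j)) (i : ι) :
    commLift (K := K) f h (X i) = f i := by
  simp [commLift]

theorem commLift_C (f : ι → S) (h : ∀ i j, Commute (f i) (f j)) (c : K) :
    commLift f h (C c) = algebraMap K S c :=
  (commLift f h).commutes c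

end Lift

variable {K : Type u} [Field K] {ι : Type} {V W : Type u} [AddCommGroup V] [Module K V]
  [AddCommGroup W] [Module K W]

/-- A vector space with commuting operators, as a module over a polynomial ring. -/
@[reducible]
noncomputable def polyModule (f : ι → Module.End K V) (h : ∀ i j, Commute (f i) (f j)) :
    Module (MvPolynomial ι K) V :=
  Module.compHom V (commLift f h : MvPolynomial ι K →ₐ[K] Module.End K V).toRingHom

theorem map_commLift {f : ι → Module.End K V} (hf : ∀ i j, Commute (f i) (f j))
    {g : ι → Module.End K W} (hg : ∀ i j, Commute (g i) (g j)) (φ : V →ₗ[K] W)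
    (h : ∀ i x, φ (f i x) = g i (φ x)) (r : MvPolynomial ι K) (x : V) :
    φ (commLift f hf r x) = commLift g hg r (φ x) := by
  induction r using MvPolynomial.induction_on generalizing x with
  | C c => simp
  | add p q hp hq => simp only [map_add, LinearMap.add_apply, hp, hq]
  | mul_X p i hp => simp only [map_mul, Module.End.mul_apply, commLift_X, hp, h]

/-- The module object of a vector space with commuting operators. -/
noncomputable def polyMod (f : ι → Module.End K V) (h : ∀ i j, Commute (f i) (f j)) :
    ModuleCat.{u} (MvPolynomial ι K) :=
  @ModuleCat.of (MvPolynomial ι K) _ V _ (polyModule f h)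

/-- A linear map intertwining commuting operators is linear over the polynomial ring. -/
noncomputable def polyHom {f : ι → Module.End K V} (hf : ∀ i j, Commute (f i) (f j))
    {g : ι → Module.End K W} (hg : ∀ i j, Commute (g i) (g j)) (φ : V →ₗ[K] W)
    (h : ∀ i x, φ (f i x) = g i (φ x)) : polyMod f hf ⟶ polyMod g hg :=
  letI := polyModule f hf
  letI := polyModule g hg
  ModuleCat.ofHom
    { toFun := φ
      map_add' := φ.map_add
      map_smul' := fun r x => map_commLift hf hg φ h r x }

/-- The module object of a vector space on which all variables act by zero. -/
noncomputable def trivMod (ι : Type) (Y : ModuleCat.{u} K) : ModuleCat.{u} (MvPolynomial ι K) :=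
  (ModuleCat.restrictScalars (constantCoeff (σ := ι) (R := K))).obj Y

/-- A linear map which kills the images of commuting operators, as a map into a module on which all
variables act by zero. -/
noncomputable def trivHom {f : ι → Module.End K V} (hf : ∀ i j, Commute (f i) (f j))
    (Y : ModuleCat.{u} K) (φ : V →ₗ[K] Y) (h : ∀ i x, φ (f i x) = 0) :
    polyMod f hf ⟶ trivMod ι Y :=
  letI := polyModule f hf
  ModuleCat.ofHom (Y := trivMod ι Y)
    { toFun := φ
      map_add' := φ.map_add
      map_smul' := fun r x => by
        change φ (commLift f hf r x) = constantCoeff r • φ x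
        induction r using MvPolynomial.induction_on generalizing x with
        | C c => simp
        | add p q hp hq => simp only [map_add, LinearMap.add_apply, hp, hq, add_smul]
        | mul_X p i hp => simp [commLift_X, hp, h] }

/-- The complex obtained from `Y` by letting all variables act by zero. -/
noncomputable def trivComplex (ι : Type) (Y : ChainComplex (ModuleCat.{u} K) ℕ) :
    ChainComplex (ModuleCat.{u} (MvPolynomial ι K)) ℕ :=
  ((ModuleCat.restrictScalars (constantCoeff (σ := ι) (R := K))).mapHomologicalComplex _).obj Y

/-- Homology does not depend on whether a complex is considered over `K` or over the polynomial
ring. -/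
noncomputable def trivComplexHomologyIso (ι : Type) (Y : ChainComplex (ModuleCat.{u} K) ℕ)
    (p : ℕ) : (trivComplex ι Y).homology p ≅ trivMod ι (Y.homology p) :=
  (Y.sc p).mapHomologyIso (ModuleCat.restrictScalars (constantCoeff (σ := ι) (R := K)))

theorem nonempty_linearEquiv_of_trivMod (Y : ModuleCat.{u} K)
    (h : Collapses K ([] : List (MvPolynomial ι K)) 0 (trivMod ι Y)) : Nonempty (Y ≃ₗ[K] K) := by
  obtain ⟨-, e, he⟩ := h
  let e' : Y ≃+ K := e
  refine ⟨e'.toLinearEquiv fun c x => ?_⟩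
  have h1 := he c x
  have h2 : (algebraMap K (MvPolynomial ι K) c • (show trivMod ι Y from x)) = c • x := by
    change constantCoeff (C c) • x = c • x
    rw [constantCoeff_C]
  rw [h2] at h1
  exact h1

section Complex

variable {V : ℕ → Type u} [∀ n, AddCommGroup (V n)] [∀ n, Module K (V n)]
  (D : ∀ n, V (n + 1) →ₗ[K] V n) (hD : ∀ n x, D n (D (n + 1) x) = 0)
  (f : ∀ n, ι → Module.End K (V n)) (hf : ∀ n i j, Commute (f n i) (f n j))
  (hDf : ∀ n i x, D n (f (n + 1) i x) = f n i (D n x))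

/-- The complex `⋯ → V 2 → V 1` of modules over the polynomial ring. -/
noncomputable def polyComplex : ChainComplex (ModuleCat.{u} (MvPolynomial ι K)) ℕ :=
  ChainComplex.of (fun p => polyMod (f (p + 1)) (hf (p + 1)))
    (fun p => polyHom (hf (p + 2)) (hf (p + 1)) (D (p + 1)) (hDf (p + 1)))
    (fun p => by
      ext x
      exact hD (p + 1) x)

theorem polyComplex_d_apply (p : ℕ) (x : V (p + 2)) :
    (polyComplex D hD f hf hDf).d (p + 1) p x = D (p + 1) x := by
  exact ConcreteCategory.congr_hom (ChainComplex.of_d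
    (fun p => polyMod (f (p + 1)) (hf (p + 1)))
    (fun p => polyHom (hf (p + 2)) (hf (p + 1)) (D (p + 1)) (hDf (p + 1))) p) x

variable (hex : ∀ n x, D n x = 0 → ∃ z, D (n + 1) z = x)

include hex in
/-- The complex is exact except in its last term. -/
theorem subsingleton_homology_succ (p : ℕ) :
    Subsingleton ((polyComplex D hD f hf hDf).homology (p + 1)) := by
  rw [← ModuleCat.isZero_iff_subsingleton, ← HomologicalComplex.exactAt_iff_isZero_homology,
    HomologicalComplex.exactAt_iff' _ (p + 2) (p + 1) p (by simp) (by simp),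
    ShortComplex.moduleCat_exact_iff]
  intro x hx
  obtain ⟨z, hz⟩ := hex (p + 1) x ((polyComplex_d_apply D hD f hf hDf p x).symm.trans hx)
  exact ⟨z, (polyComplex_d_apply D hD f hf hDf (p + 1) z).trans hz⟩

include hex in
/-- The homology in degree zero is the augmentation module `V 0`. -/
theorem nonempty_homology_zero (hsurj : Function.Surjective (D 0)) :
    Nonempty ((polyComplex D hD f hf hDf).homology 0 ≃ₗ[MvPolynomial ι K] polyMod (f 0) (hf 0)) := by
  let X := polyComplex D hD f hf hDf
  let ε : X.X 0 ⟶ polyMod (f 0) (hf 0) := polyHom (hf 1) (hf 0) (D 0) (hDf 0)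
  have hε : X.d 1 0 ≫ ε = 0 := by
    ext x
    refine (congrArg (D 0) (polyComplex_d_apply D hD f hf hDf 0 x)).trans (hD 0 x)
  have hepi : Epi ε := (ModuleCat.epi_iff_surjective ε).2 hsurj
  have hexact : (ShortComplex.mk _ _ hε).Exact := by
    rw [ShortComplex.moduleCat_exact_iff]
    intro x hx
    obtain ⟨z, hz⟩ := hex 0 x hx
    exact ⟨z, (polyComplex_d_apply D hD f hf hDf 0 z).trans hz⟩
  exact ⟨(X.isoHomologyι₀ ≪≫ Limits.IsColimit.coconePointUniqueUpToIso
    (X.opcyclesIsCokernel 1 0 (by simp)) hexact.gIsCokernel).toLinearEquiv⟩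

end Complex

/-- A complex `⋯ → V 2 → V 1 → V 0 → 0` is exact, and carries commuting operators `f`; these are
creation operators of a Heisenberg algebra on `V (p + 1)`, while `V 0` is a Fock space. Then the
quotient of `⋯ → V 2 → V 1` by the images of the operators has one-dimensional homology, in the
degree equal to the number of annihilation operators on `V 0`. -/
theorem homology_of_fockSpace [CharZero K] {m : ℕ} {V : ℕ → Type u} [∀ n, AddCommGroup (V n)]
    [∀ n, Module K (V n)]
    (D : ∀ n, V (n + 1) →ₗ[K] V n) (hD : ∀ n x, D n (D (n + 1) x) = 0)
    (hex : ∀ n x, D n x = 0 → ∃ z, D (n + 1) z = x) (hsurj : Function.Surjective (D 0))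
    (f : ∀ n, Fin m → Module.End K (V n)) (hf : ∀ n i j, Commute (f n i) (f n j))
    (hDf : ∀ n i x, D n (f (n + 1) i x) = f n i (D n x))
    -- the operators act on `V (p + 1)` as creation operators
    (g : ∀ p, Fin m → Module.End K (V (p + 1)))
    (hgf : ∀ p i j x, g p i (f (p + 1) j x) = f (p + 1) j (g p i x) + if i = j then x else 0)
    (hg : ∀ p i, LocNil.IsLocNil (g p i))
    -- `V 0` is a Fock space
    (b : Fin m → Prop) [DecidablePred b] (s : Fin m → Module.End K (V 0)) (Ω : V 0)
    (hs : ∀ i j x, i ≤ j → s j (f 0 i x) + (if b i ∧ i = j then x else 0) =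
      f 0 i (s j x) + if ¬ b i ∧ i = j then x else 0)
    (hcomm : ∀ i j x, ¬ b i → ¬ b j → s i (s j x) = s j (s i x))
    (hmono : ∀ i j, b j → ¬ b i → j < i)
    (hfnil : ∀ i, b i → LocNil.IsLocNil (f 0 i)) (hsnil : ∀ i, ¬ b i → LocNil.IsLocNil (s i))
    (hΩ : Ω ≠ 0) (hΩf : ∀ i, b i → f 0 i Ω = 0) (hΩs : ∀ i, ¬ b i → s i Ω = 0)
    (huniq : ∀ x, (∀ i, b i → f 0 i x = 0) → (∀ i, ¬ b i → s i x = 0) → ∃ c : K, x = c • Ω)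
    -- the quotient complex
    (Y : ChainComplex (ModuleCat.{u} K) ℕ) (π : ∀ p, V (p + 1) →ₗ[K] Y.X p)
    (hπ : ∀ p x, π p (D (p + 1) x) = Y.d (p + 1) p (π (p + 1) x))
    (hπs : ∀ p, Function.Surjective (π p)) (hπf : ∀ p i x, π p (f (p + 1) i x) = 0)
    (hπker : ∀ p x, π p x = 0 → x ∈ ⨆ i, LinearMap.range (f (p + 1) i)) :
    (∀ p, p ≠ (∑ i, if b i then 1 else 0) → Subsingleton (Y.homology p)) ∧
      Nonempty (Y.homology (∑ i, if b i then 1 else 0) ≃ₗ[K] K) := by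
  let B := polyComplex D hD f hf hDf
  let φ : B ⟶ trivComplex (Fin m) Y :=
    { f := fun p => trivHom (hf (p + 1)) (Y.X p) (π p) (hπf p)
      comm' := by
        rintro _ p rfl
        ext x
        exact ((congrArg (π p) (polyComplex_d_apply D hD f hf hDf p x)).trans (hπ p x)).symm }
  have hX : ∀ (n : ℕ) (i : Fin m) (x : polyMod (f n) (hf n)),
      (X i : MvPolynomial (Fin m) K) • x = f n i x := fun n i x => by
    change commLift (f n) (hf n) (X i) x = f n i x
    rw [commLift_X]
  have hC : ∀ (n : ℕ) (c : K) (x : polyMod (f n) (hf n)),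
      (algebraMap K (MvPolynomial (Fin m) K) c) • x = (show V n from c • (show V n from x)) :=
    fun n c x => by
      change commLift (f n) (hf n) (C c) x = _
      rw [commLift_C]
      rfl
  have hit : ∀ (n : ℕ) (h : Module.End K (V n)), LocNil.IsLocNil h → ∀ x, ∃ k : ℕ, h^[k] x = 0 :=
    fun n h hh x => by
      obtain ⟨k, hk⟩ := hh x
      exact ⟨k, by rwa [← Module.End.pow_apply]⟩
  have key := CollapsingHomology.homology_of_collapses (K := K)
    (List.ofFn (X : Fin m → MvPolynomial (Fin m) K)) φ 0 (∑ i, if b i then 1 else 0) ?_ ?_ ?_ ?_ ?_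
  · rw [zero_add] at key
    refine ⟨fun p hp => ?_, nonempty_linearEquiv_of_trivMod (ι := Fin m) _
      (key.2.congr (trivComplexHomologyIso (Fin m) Y _).toLinearEquiv)⟩
    have := key.1 p hp
    exact (trivComplexHomologyIso (Fin m) Y p).toLinearEquiv.symm.toEquiv.subsingleton
  · intro p
    refine Heisenberg.isWeaklyRegular K (M := polyMod (f (p + 1)) (hf (p + 1))) _
      (fun i => (g p i).toAddMonoidHom) (fun i j x => ?_) (fun i => hit _ _ (hg p i))
    exact (congrArg (g p i) (hX (p + 1) j x)).trans ((hgf p i j x).trans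
      (congrArg (· + if i = j then x else 0) (hX (p + 1) j (g p i x)).symm))
  · exact hπs
  · intro p
    refine le_antisymm (fun x hx => ?_) ?_
    · have hle : ∀ y : V (p + 1), y ∈ ⨆ i, LinearMap.range (f (p + 1) i) →
          (show B.X p from y) ∈ (Ideal.ofList (List.ofFn (X : Fin m → MvPolynomial (Fin m) K)) •
            ⊤ : Submodule (MvPolynomial (Fin m) K) (B.X p)) := by
        intro y hy
        induction hy using Submodule.iSup_induction' with
        | mem i y hy =>
          obtain ⟨z, rfl⟩ := hy
          rw [← hX (p + 1) i z]
          refine Submodule.smul_mem_smul (Ideal.subset_span ?_) trivial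
          simp [List.mem_ofFn]
        | zero => exact Submodule.zero_mem _
        | add y z _ _ hy hz => exact Submodule.add_mem _ hy hz
      exact hle x (hπker p x hx)
    · rw [Submodule.smul_le]
      intro r hr x _
      have hr0 : constantCoeff r = 0 := by
        have : Ideal.ofList (List.ofFn (X : Fin m → MvPolynomial (Fin m) K)) ≤
            RingHom.ker (constantCoeff (σ := Fin m) (R := K)) := by
          refine Ideal.span_le.2 fun r hr => ?_
          obtain ⟨i, rfl⟩ := (List.mem_ofFn' _ _).1 hr
          simp
        exact this hr
      rw [LinearMap.mem_ker, map_smul]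
      change constantCoeff r • π p x = 0
      rw [hr0, zero_smul]
  · intro p hp
    obtain ⟨q, rfl⟩ := Nat.exists_eq_succ_of_ne_zero hp
    exact subsingleton_homology_succ D hD f hf hDf hex q
  · obtain ⟨e⟩ := nonempty_homology_zero D hD f hf hDf hex hsurj
    refine Collapses.congr e.symm ?_
    refine Heisenberg.collapses K (polyMod (f 0) (hf 0)) b _ (fun i => (s i).toAddMonoidHom) Ω
      ?_ hcomm hmono ?_ (fun i hi => hit _ _ (hsnil i hi)) hΩ ?_ hΩs ?_
    · intro i j (x : V 0) hij
      exact (congrArg (fun y => s j y + if b i ∧ i = j then x else 0) (hX 0 i x)).trans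
        ((hs i j x hij).trans (congrArg (· + if ¬ b i ∧ i = j then x else 0)
          (hX 0 i (s j x)).symm))
    · intro i hi x
      have : (fun y : polyMod (f 0) (hf 0) => (X i : MvPolynomial (Fin m) K) • y) = f 0 i :=
        funext fun y => hX 0 i y
      rw [this]
      exact hit _ _ (hfnil i hi) x
    · exact fun i hi => (hX 0 i Ω).trans (hΩf i hi)
    · intro x h1 h2
      obtain ⟨c, hc⟩ := huniq x (fun i hi => (hX 0 i x).symm.trans (h1 i hi)) h2
      exact ⟨c, hc.trans (hC 0 c Ω).symm⟩

end CommOperators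

/-! ### Twisted Hochschild homology from Fock spaces -/

namespace Bar

universe u

section

variable (K : Type u) [CommRing K] {A : Type u} [Ring A] [Algebra K A]

/-- The operator `f` applied to the last factor. -/
noncomputable def last (n : ℕ) (f : Module.End K A) : Module.End K (Tens K A (n + 1)) :=
  (snoc K n).conj (LinearMap.lTensor (Tens K A n) f)

theorem last_snoc (n : ℕ) (f : Module.End K A) (t : Tens K A n) (x : A) :
    last K n f (snoc K n (t ⊗ₜ x)) = snoc K n (t ⊗ₜ f x) := by
  simp [last]

/-- The tensor power `A^{⊗1}` is `A`. -/
noncomputable def tensOne : Tens K A 1 ≃ₗ[K] A :=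
  PiTensorProduct.subsingletonEquiv (R := K) (s := fun _ : Fin 1 => A) (0 : Fin 1)

theorem tensOne_head (f : Module.End K A) (t : Tens K A 1) :
    tensOne K (head K 0 f t) = f (tensOne K t) := by
  induction t using PiTensorProduct.induction_on with
  | smul_tprod c a =>
    simp only [map_smul, head_tprod]
    congr 1
    exact (PiTensorProduct.subsingletonEquiv_apply_tprod 0 _).trans
      (by rw [Function.update_self]; exact congrArg f
            (PiTensorProduct.subsingletonEquiv_apply_tprod (s := fun _ : Fin 1 => A) 0 a).symm)
  | add a b ha hb => simp only [map_add, ha, hb]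

theorem tensOne_rmul (x : A) (t : Tens K A 1) :
    tensOne K (rmul K 0 x t) = tensOne K t * x := by
  have : rmul K 0 x = head K 0 (LinearMap.mulRight K x) :=
    ext_snoc fun t y => by rw [rmul_snoc, head_zero_snoc]; rfl
  rw [this, tensOne_head]
  rfl

end

variable {K : Type u} [Field K] {A : Type u} [Ring A] [Algebra K A]

theorem isLocNil_conj {V W : Type*} [AddCommGroup V] [Module K V] [AddCommGroup W] [Module K W]
    (e : V ≃ₗ[K] W) {f : Module.End K V} (hf : LocNil.IsLocNil f) {g : Module.End K W}
    (h : ∀ x, e (f x) = g (e x)) : LocNil.IsLocNil g := by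
  intro y
  obtain ⟨x, rfl⟩ := e.surjective y
  obtain ⟨r, hr⟩ := hf x
  refine ⟨r, ?_⟩
  have : Function.Semiconj e f g := h
  rw [Module.End.pow_apply] at hr ⊢
  rw [← (this.iterate_right r).eq x, hr, map_zero]

/-- Modulo the images of the twisted commutators with generators of `A`, the last factor can be
moved to the front. -/
theorem exists_sub_mem {ι : Type*} (γ : A ≃ₐ[K] A) (v : ι → A)
    (hgen : ∀ S : Submodule K A, 1 ∈ S → (∀ i, ∀ y ∈ S, y * v i ∈ S) → ∀ y, y ∈ S) (n : ℕ)
    (t : Tens K A (n + 2)) : ∃ z : Tens K A (n + 1),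
      t - snoc K (n + 1) (z ⊗ₜ 1) ∈ ⨆ i, LinearMap.range (twistedComm γ (n + 1) (v i)) := by
  set W := ⨆ i, LinearMap.range (twistedComm γ (n + 1) (v i))
  let S : Submodule K A :=
    { carrier := {y | ∀ t : Tens K A (n + 1), ∃ z : Tens K A (n + 1),
        snoc K (n + 1) (t ⊗ₜ y) - snoc K (n + 1) (z ⊗ₜ 1) ∈ W}
      zero_mem' := fun t => ⟨0, by simp⟩
      add_mem' := by
        intro x y hx hy t
        obtain ⟨z, hz⟩ := hx t
        obtain ⟨w, hw⟩ := hy t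
        refine ⟨z + w, ?_⟩
        rw [TensorProduct.tmul_add, TensorProduct.add_tmul, map_add, map_add, add_sub_add_comm]
        exact W.add_mem hz hw
      smul_mem' := by
        intro c x hx t
        obtain ⟨z, hz⟩ := hx t
        refine ⟨c • z, ?_⟩
        rw [TensorProduct.tmul_smul, ← TensorProduct.smul_tmul', map_smul, map_smul, ← smul_sub]
        exact W.smul_mem c hz }
  have hS : ∀ y, y ∈ S := by
    refine hgen S (fun t => ⟨t, by simp⟩) fun i y hy t => ?_
    obtain ⟨z, hz⟩ := hy (head K n (LinearMap.mulLeft K (γ.symm (v i))) t)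
    refine ⟨z, ?_⟩
    have h1 : twistedComm γ (n + 1) (v i) (snoc K (n + 1) (t ⊗ₜ y)) ∈ W :=
      (le_iSup (fun i => LinearMap.range (twistedComm γ (n + 1) (v i))) i) ⟨_, rfl⟩
    rw [twistedComm_apply, rmul_snoc, head_succ_snoc] at h1
    simpa using W.add_mem h1 hz
  obtain ⟨t, rfl⟩ := (snoc K (n + 1)).surjective t
  induction t with
  | zero => exact ⟨0, by simp⟩
  | tmul t y => exact hS y t
  | add s t hs ht =>
    obtain ⟨z, hz⟩ := hs
    obtain ⟨w, hw⟩ := ht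
    refine ⟨z + w, ?_⟩
    rw [TensorProduct.add_tmul, map_add, map_add, add_sub_add_comm]
    exact W.add_mem hz hw

/-- The kernel of the projection onto the twisted complex is spanned by twisted commutators with
generators: an element of the kernel is, modulo those, of the form `z ⊗ 1`, and `proj` is injective
on such elements. -/
theorem mem_of_proj_eq_zero {ι : Type*} (γ : A ≃ₐ[K] A) (v : ι → A)
    (hgen : ∀ S : Submodule K A, 1 ∈ S → (∀ i, ∀ y ∈ S, y * v i ∈ S) → ∀ y, y ∈ S) (n : ℕ)
    (t : Tens K A (n + 2)) (ht : proj γ n t = 0) :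
    t ∈ ⨆ i, LinearMap.range (twistedComm γ (n + 1) (v i)) := by
  obtain ⟨z, hz⟩ := exists_sub_mem γ v hgen n t
  have hle : ⨆ i, LinearMap.range (twistedComm γ (n + 1) (v i)) ≤ LinearMap.ker (proj γ n) := by
    refine iSup_le fun i => ?_
    rintro _ ⟨y, rfl⟩
    exact proj_twistedComm γ n (v i) y
  have h1 : proj γ n (t - snoc K (n + 1) (z ⊗ₜ 1)) = 0 := hle hz
  rw [map_sub, ht, zero_sub, neg_eq_zero, proj_snoc_one] at h1
  have hz0 : z = 0 := (head_toLinearMap_bijective γ n).1 (by rw [h1, map_zero])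
  simpa [hz0] using hz

/-- Twisted Hochschild homology of an algebra `A` generated by elements `v i` with scalar
commutators, on which there are dual derivations `δ i`, provided that the twisted commutators
`a ↦ a v i - γ⁻¹(v i) a` turn `A` into a Fock space with vacuum `1`. -/
theorem twistedHomology_of_fockSpace [CharZero K] [Nontrivial A] (γ : A ≃ₐ[K] A) {m : ℕ}
    (v : Fin m → A)
    (hv : ∀ i j, ∃ k : K, v i * v j - v j * v i = algebraMap K A k)
    (hgen : ∀ S : Submodule K A, 1 ∈ S → (∀ i, ∀ y ∈ S, y * v i ∈ S) → ∀ y, y ∈ S)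
    (δ : Fin m → Module.End K A) (hδ : ∀ i j y, δ i (y * v j) = δ i y * v j + if i = j then y else 0)
    (hδnil : ∀ i, LocNil.IsLocNil (δ i))
    (b : Fin m → Prop) [DecidablePred b] (r s : Fin m → Module.End K A)
    (hr : ∀ i a, r i a = a * v i - γ.symm (v i) * a)
    (hs : ∀ i j x, i ≤ j → s j (r i x) + (if b i ∧ i = j then x else 0) =
      r i (s j x) + if ¬ b i ∧ i = j then x else 0)
    (hcomm : ∀ i j x, ¬ b i → ¬ b j → s i (s j x) = s j (s i x))
    (hmono : ∀ i j, b j → ¬ b i → j < i)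
    (hrnil : ∀ i, b i → LocNil.IsLocNil (r i)) (hsnil : ∀ i, ¬ b i → LocNil.IsLocNil (s i))
    (hr1 : ∀ i, b i → r i 1 = 0) (hs1 : ∀ i, ¬ b i → s i 1 = 0)
    (huniq : ∀ x, (∀ i, b i → r i x = 0) → (∀ i, ¬ b i → s i x = 0) → ∃ c : K, x = c • 1) :
    (∀ p, p ≠ (∑ i, if b i then 1 else 0) → Subsingleton (Hochschild.HH K γ p)) ∧
      Nonempty (Hochschild.HH K γ (∑ i, if b i then 1 else 0) ≃ₗ[K] K) := by
  let e := tensOne K (A := A)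
  have he : ∀ i t, e (twistedComm γ 0 (v i) t) = r i (e t) := fun i t => by
    rw [twistedComm_apply, map_sub, tensOne_rmul, tensOne_head, hr]
    rfl
  have he' : ∀ i t, e (head K 0 (s i) t) = s i (e t) := fun i t => tensOne_head K (s i) t
  have hconj : ∀ {f : Module.End K A} {g : Module.End K (Tens K A 1)}, LocNil.IsLocNil f →
      (∀ t, e (g t) = f (e t)) → LocNil.IsLocNil g := fun {f g} hf h =>
    isLocNil_conj e.symm hf fun x => by
      rw [LinearEquiv.symm_apply_eq, h, LinearEquiv.apply_symm_apply]
  have hzero : ∀ t, t = 0 ↔ e t = 0 := fun t => (LinearEquiv.map_eq_zero_iff e).symm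
  have hlast : ∀ p i, LocNil.IsLocNil (last K (p + 1) (δ i)) := fun p i =>
    isLocNil_conj (snoc K (p + 1)) (f := LinearMap.lTensor (Tens K A (p + 1)) (δ i))
      (LocNil.IsLocNil.map_right (f := LinearMap.id) (hδnil i)) fun x => by simp [last]
  refine CommOperators.homology_of_fockSpace (V := fun n => Tens K A (n + 1))
    (fun n => d K (n + 1)) (fun n => d_d K (n + 1)) (fun n => exists_of_d_eq_zero K (n + 1))
    (fun t => exists_of_d_eq_zero K 0 t rfl) (fun n i => twistedComm γ n (v i))
    (fun n i j => ?_) (fun n i => d_twistedComm γ n (v i)) (fun p i => last K (p + 1) (δ i))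
    (fun p i j t => ?_) hlast
    b (fun i => head K 0 (s i)) (e.symm 1) ?_ ?_ hmono (fun i hi => hconj (hrnil i hi) (he i))
    (fun i hi => hconj (hsnil i hi) (he' i)) ?_ ?_ ?_ ?_ (Hochschild.twistedComplex K γ)
    (fun p => proj γ p) (fun p t => ?_) (fun p => proj_surjective γ p)
    (fun p i => proj_twistedComm γ p (v i)) (fun p t => mem_of_proj_eq_zero γ v hgen p t)
  · obtain ⟨k, hk⟩ := hv i j
    exact twistedComm_commute γ n _ _ k hk
  · suffices h : last K (p + 1) (δ i) ∘ₗ twistedComm γ (p + 1) (v j) =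
        twistedComm γ (p + 1) (v j) ∘ₗ last K (p + 1) (δ i) + if i = j then LinearMap.id else 0 by
      have := LinearMap.congr_fun h t
      by_cases hij : i = j
      · simpa [hij] using this
      · simpa [hij] using this
    refine ext_snoc fun t y => ?_
    by_cases hij : i = j
    · simp only [LinearMap.comp_apply, LinearMap.add_apply, twistedComm_apply, rmul_snoc,
        head_succ_snoc, map_sub, last_snoc, hδ, hij, if_true, TensorProduct.tmul_add, map_add,
        LinearMap.id_apply]
      abel
    · simp only [LinearMap.comp_apply, twistedComm_apply, rmul_snoc, head_succ_snoc, map_sub,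
        last_snoc, hδ, hij, if_false, add_zero]
  · intro i j x hij
    apply e.injective
    have := hs i j (e x) hij
    rw [map_add, map_add, he', he, he, he', apply_ite e, apply_ite e, map_zero]
    exact this
  · intro i j x hi hj
    apply e.injective
    rw [he', he', he', he', hcomm _ _ _ hi hj]
  · rw [Ne, hzero, LinearEquiv.apply_symm_apply]
    exact one_ne_zero
  · intro i hi
    rw [hzero, he, LinearEquiv.apply_symm_apply, hr1 i hi]
  · intro i hi
    rw [hzero, he', LinearEquiv.apply_symm_apply, hs1 i hi]
  · intro x h1 h2
    obtain ⟨c, hc⟩ := huniq (e x) (fun i hi => by rw [← he, h1 i hi, map_zero])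
      (fun i hi => by rw [← he', h2 i hi, map_zero])
    exact ⟨c, e.injective (by rw [hc, map_smul, LinearEquiv.apply_symm_apply])⟩
  · refine (proj_d γ p t).trans ?_
    exact (CategoryTheory.ConcreteCategory.congr_hom (ChainComplex.of_d
      (fun p => ModuleCat.of K (⨂[K] _ : Fin (p + 1), A))
      (fun p => ModuleCat.ofHom (Hochschild.boundary K γ p)) p) (proj γ (p + 1) t)).symm

end Bar

/-! ### Linear forms and constant vector fields on the Weyl algebra -/

namespace Weyl

open LocNil MvPolynomial Matrix

noncomputable section

variable {K : Type} [Field K] {n : ℕ}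

/-- The linear form with coefficients `c` in the coordinate functions, as a polynomial. -/
def lin : (Fin n ⊕ Fin n → K) →ₗ[K] Poly K n :=
  Fintype.linearCombination K fun s => X s

/-- The derivative along the constant vector field with coordinates `v`. -/
def dir (v : Fin n ⊕ Fin n → K) : Module.End K (Poly K n) := ∑ s, v s • partialD K n s

/-- The constant vector field which is, up to sign, the Hamiltonian vector field of the linear form
with coefficients `c`. -/
def ham (c : Fin n ⊕ Fin n → K) : Fin n ⊕ Fin n → K :=
  Sum.elim (fun i => -c (Sum.inr i)) fun i => c (Sum.inl i)

theorem lin_apply (c : Fin n ⊕ Fin n → K) : lin c = ∑ s, c s • (X s : Poly K n) := rfl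

theorem dir_apply (v : Fin n ⊕ Fin n → K) (f : Poly K n) : dir v f = ∑ s, v s • pderiv s f := by
  simp [dir, partialD]

theorem dir_mul (v : Fin n ⊕ Fin n → K) (f g : Poly K n) :
    dir v (f * g) = dir v f * g + f * dir v g := by
  simp only [dir_apply, Derivation.leibniz, smul_eq_mul, smul_add, Finset.sum_add_distrib,
    Finset.sum_mul, Finset.mul_sum, smul_mul_assoc, mul_smul_comm]
  rw [add_comm]
  simp only [mul_comm]

theorem dir_lin (v c : Fin n ⊕ Fin n → K) : dir v (lin c) = C (v ⬝ᵥ c) := by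
  simp only [dir_apply, lin_apply, map_sum, Derivation.map_smul, pderiv_X, Pi.single_apply,
    smul_ite, smul_zero, Finset.sum_ite_eq, Finset.mem_univ, if_true, dotProduct, C_mul]
  simp only [MvPolynomial.smul_eq_C_mul, mul_one]

theorem partialD_lin (s : Fin n ⊕ Fin n) (c : Fin n ⊕ Fin n → K) :
    partialD K n s (lin c) = c s • (1 : Poly K n) := by
  have := dir_lin (Pi.single s 1) c
  simpa [dir, Pi.single_apply, C_eq_smul_one] using this

theorem dir_lin_mul (v c : Fin n ⊕ Fin n → K) (f : Poly K n) :
    dir v (lin c * f) = lin c * dir v f + (v ⬝ᵥ c) • f := by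
  rw [dir_mul, dir_lin, MvPolynomial.smul_eq_C_mul, add_comm]

theorem dir_comm (v w : Fin n ⊕ Fin n → K) : Commute (dir v) (dir w) :=
  Commute.sum_left _ _ _ fun s _ => Commute.sum_right _ _ _ fun t _ =>
    ((partialD_comm K n s t).smul_left _).smul_right _

theorem dir_locNil (v : Fin n ⊕ Fin n → K) : IsLocNil (dir v) :=
  IsLocNil.sum _ _ (fun s => (partialD_locNil K n s).smul _) fun s t =>
    ((partialD_comm K n s t).smul_left _).smul_right _

theorem dir_one (v : Fin n ⊕ Fin n → K) : dir v (1 : Poly K n) = 0 := by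
  simp [dir_apply]

/-- In characteristic zero, a polynomial all of whose partial derivatives vanish is constant. -/
theorem eq_C_of_pderiv_eq_zero [CharZero K] {σ : Type*} (f : MvPolynomial σ K)
    (h : ∀ s, pderiv s f = 0) : f = C (coeff 0 f) := by
  classical
  ext m
  rw [coeff_C]
  split_ifs with hm
  · rw [hm]
  · obtain ⟨s, hs⟩ := Finsupp.ne_iff.1 (Ne.symm hm)
    have h1 := congrArg (coeff (m - Finsupp.single s 1)) (h s)
    have h2 : m - Finsupp.single s 1 + Finsupp.single s 1 = m :=
      tsub_add_cancel_of_le (by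
        simpa [Nat.one_le_iff_ne_zero] using hs)
    rw [coeff_pderiv, h2, coeff_zero] at h1
    refine (mul_eq_zero.1 h1).resolve_right ?_
    exact Nat.cast_add_one_ne_zero _

variable (h : K)

/-- The Moyal product with a linear form stops after the first order in `h`. -/
theorem moyal_lin (f : Poly K n) (c : Fin n ⊕ Fin n → K) :
    moyal h n f (lin c) = lin c * f - h • dir (ham c) f := by
  have h1 : poisson K n (f ⊗ₜ lin c) = -(dir (ham c) f ⊗ₜ[K] (1 : Poly K n)) := by
    simp only [poisson, LinearMap.sum_apply, LinearMap.sub_apply, TensorProduct.map_tmul,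
      partialD_lin, dir, LinearMap.smul_apply, LinearMap.add_apply, ham, Fintype.sum_sum_type,
      Sum.elim_inl, Sum.elim_inr, TensorProduct.add_tmul, TensorProduct.sum_tmul, ← TensorProduct.smul_tmul',
      neg_smul, Finset.sum_sub_distrib, Finset.sum_neg_distrib, TensorProduct.tmul_smul,
      TensorProduct.neg_tmul]
    abel
  have h2 : poisson K n (dir (ham c) f ⊗ₜ[K] (1 : Poly K n)) = 0 := by
    simp [poisson, partialD]
  rw [moyal, lexp_eq_sum (r := 2)]
  · simp only [Finset.sum_range_succ, Finset.sum_range_zero, pow_zero, pow_one,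
      LinearMap.smul_apply, h1]
    simp [mul_comm, sub_eq_add_neg]
  · rw [pow_two, Module.End.mul_apply, LinearMap.smul_apply, LinearMap.smul_apply, h1, map_smul,
      map_neg, h2, neg_zero, smul_zero, smul_zero]

theorem lin_moyal (f : Poly K n) (c : Fin n ⊕ Fin n → K) :
    moyal h n (lin c) f = lin c * f + h • dir (ham c) f := by
  have h1 : poisson K n (lin c ⊗ₜ f) = (1 : Poly K n) ⊗ₜ[K] dir (ham c) f := by
    simp only [poisson, LinearMap.sum_apply, LinearMap.sub_apply, TensorProduct.map_tmul,
      partialD_lin, dir, LinearMap.smul_apply, LinearMap.add_apply, ham, Fintype.sum_sum_type,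
      Sum.elim_inl, Sum.elim_inr, TensorProduct.tmul_add, TensorProduct.tmul_sum, ← TensorProduct.smul_tmul',
      neg_smul, Finset.sum_sub_distrib, Finset.sum_neg_distrib, TensorProduct.tmul_smul,
      TensorProduct.tmul_neg]
    abel
  have h2 : poisson K n ((1 : Poly K n) ⊗ₜ[K] dir (ham c) f) = 0 := by
    simp [poisson, partialD]
  rw [moyal, lexp_eq_sum (r := 2)]
  · simp only [Finset.sum_range_succ, Finset.sum_range_zero, pow_zero, pow_one,
      LinearMap.smul_apply, h1]
    simp
  · rw [pow_two, Module.End.mul_apply, LinearMap.smul_apply, LinearMap.smul_apply, h1, map_smul,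
      h2, smul_zero, smul_zero]

/-- On linear forms, `γ⁻¹` acts on coefficient vectors through the matrix of `γ` from the right. -/
theorem subst_inv_lin (ρ : ℝ →+* K) (γ : symplecticGroup (Fin n) ℝ) (c : Fin n ⊕ Fin n → K) :
    subst ρ γ⁻¹ (lin c) = lin (c ᵥ* γ.1.map ρ) := by
  simp only [lin_apply, subst, map_sum, map_smul, aeval_X, inv_inv, vecMul, dotProduct,
    Finset.sum_smul, Finset.smul_sum, map_apply]
  rw [Finset.sum_comm]
  simp only [MvPolynomial.smul_eq_C_mul, C_mul, mul_assoc]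

/-- The Weyl algebra is generated by the linear forms, under right multiplication. -/
theorem mem_of_moyal_lin_mem (S : Submodule K (Poly K n)) (h1 : 1 ∈ S)
    (hS : ∀ c, ∀ f ∈ S, moyal h n f (lin c) ∈ S) (f : Poly K n) : f ∈ S := by
  -- `xₛ m' = m' ⋆ xₛ + h ∂ m'` with `∂ m'` of smaller degree, so one can induct on the degree
  have key : ∀ d : ℕ, ∀ m : Fin n ⊕ Fin n →₀ ℕ, m.degree ≤ d → ∀ k : K, monomial m k ∈ S := by
    intro d
    induction d using Nat.strong_induction_on with
    | _ d ih =>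
      intro m hm k
      by_cases h0 : m = 0
      · subst h0
        have := S.smul_mem k h1
        rwa [MvPolynomial.smul_eq_C_mul, mul_one] at this
      · obtain ⟨s, hs⟩ := Finsupp.ne_iff.1 h0
        obtain ⟨m', rfl⟩ : ∃ m', m = m' + Finsupp.single s 1 :=
          ⟨m - Finsupp.single s 1, (tsub_add_cancel_of_le (by
            simpa [Nat.one_le_iff_ne_zero] using hs)).symm⟩
        have hm' : m'.degree < d := by
          have : m'.degree + 1 ≤ d := by simpa using hm
          omega
        have h2 := hS (Pi.single s 1) _ (ih _ hm' m' le_rfl k)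
        have h3 : lin (Pi.single s 1) = (X s : Poly K n) := by
          simp [lin_apply, Pi.single_apply]
        have h4 : dir (ham (Pi.single s 1)) (monomial m' k) ∈ S := by
          rw [dir_apply]
          refine S.sum_mem fun t _ => S.smul_mem _ ?_
          rw [pderiv_monomial]
          exact ih _ hm' _ (Finsupp.degree_mono tsub_le_self) _
        rw [moyal_lin, h3] at h2
        have h5 := S.add_mem h2 (S.smul_mem h h4)
        rwa [sub_add_cancel, mul_comm, ← pow_one (X s), ← monomial_add_single] at h5
  rw [f.as_sum]
  exact S.sum_mem fun m _ => key _ m le_rfl _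

end

end Weyl

/-! ### Homology of the Weyl algebra from adapted bases -/

namespace Weyl

open LocNil MvPolynomial Matrix

noncomputable section

variable {K : Type} [Field K] {n : ℕ} (h : K)

instance : Nontrivial (WeylAlgebra h n) := inferInstanceAs (Nontrivial (Poly K n))

/-- Multiplication by a linear form, for the commutative product. -/
def mulLin (c : Fin n ⊕ Fin n → K) : Module.End K (Poly K n) := LinearMap.mulLeft K (lin c)

theorem dir_mulLin (v c : Fin n ⊕ Fin n → K) (f : Poly K n) :
    dir v (mulLin c f) = mulLin c (dir v f) + (v ⬝ᵥ c) • f :=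
  dir_lin_mul v c f

theorem dir_dir (v w : Fin n ⊕ Fin n → K) (f : Poly K n) :
    dir v (dir w f) = dir w (dir v f) :=
  LinearMap.congr_fun (dir_comm v w) f

/-- The twisted commutator with a linear form is a linear form plus a constant vector field. -/
theorem moyal_lin_sub (ρ : ℝ →+* K) (γ : symplecticGroup (Fin n) ℝ) (c : Fin n ⊕ Fin n → K)
    (f : Poly K n) : moyal h n f (lin c) - moyal h n (subst ρ γ⁻¹ (lin c)) f =
      mulLin (c - c ᵥ* γ.1.map ρ) f - h • dir (ham (c + c ᵥ* γ.1.map ρ)) f := by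
  have h1 : ∀ c e : Fin n ⊕ Fin n → K, dir (ham (c + e)) f = dir (ham c) f + dir (ham e) f := by
    intro c e
    simp only [dir_apply, ← Finset.sum_add_distrib, ← add_smul]
    refine Finset.sum_congr rfl fun s _ => ?_
    rcases s with s | s <;> simp [ham, add_comm]
  rw [subst_inv_lin, moyal_lin, lin_moyal, h1, mulLin, LinearMap.mulLeft_apply, map_sub, sub_mul,
    smul_add]
  abel

/-- Let `c` and `y` be bases of the linear forms, with dual bases `φ` and `ψ`. If `c i` is fixed by
`γ` and `ψ i` is its Hamiltonian vector field for `i` in `b`, and if `y i = c i - γ⁻¹ c i` for the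
other `i`, then the twisted homology is one-dimensional, in degree the size of `b`: for `i` in `b`
the twisted commutator with `c i` is a derivative, with partner the multiplication by `y i`, and for
the other `i` it is multiplication by `y i` plus a derivative, with partner the derivative along
`ψ i`. -/
theorem twistedHomology_of_adaptedBases [CharZero K] (hh : h ≠ 0) (ρ : ℝ →+* K)
    (γ : symplecticGroup (Fin n) ℝ) {N : ℕ} (b : Fin N → Prop) [DecidablePred b]
    (hmono : ∀ i j, b j → ¬ b i → j < i) (c φ y ψ : Fin N → Fin n ⊕ Fin n → K)
    (hφc : ∀ i j, φ i ⬝ᵥ c j = if i = j then 1 else 0)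
    (hc : ∀ x, ∑ i, (φ i ⬝ᵥ x) • c i = x)
    (hψy : ∀ i j, ψ i ⬝ᵥ y j = if i = j then 1 else 0)
    (hy : ∀ x, ∑ i, (ψ i ⬝ᵥ x) • y i = x)
    (hfix : ∀ i, b i → c i ᵥ* γ.1.map ρ = c i) (hham : ∀ i, b i → ψ i = ham (c i))
    (hmove : ∀ i, ¬ b i → c i - c i ᵥ* γ.1.map ρ = y i) :
    (∀ p, p ≠ (∑ i, if b i then 1 else 0) → Subsingleton (Hochschild.HH K (act h ρ γ) p)) ∧
      Nonempty (Hochschild.HH K (act h ρ γ) (∑ i, if b i then 1 else 0) ≃ₗ[K] K) := by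
  obtain ⟨ε, hε, h2⟩ : ∃ ε, ε = -2 * h ∧ ε ≠ 0 :=
    ⟨_, rfl, mul_ne_zero (neg_ne_zero.2 two_ne_zero) hh⟩
  let r : Fin N → Module.End K (Poly K n) := fun i =>
    mulLin (c i - c i ᵥ* γ.1.map ρ) - h • dir (ham (c i + c i ᵥ* γ.1.map ρ))
  let s : Fin N → Module.End K (Poly K n) := fun i =>
    if b i then ε⁻¹ • mulLin (y i) else dir (ψ i)
  have hrb : ∀ i, b i → r i = ε • dir (ψ i) := by
    intro i hi
    refine LinearMap.ext fun f => ?_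
    have h1 : ham (c i + c i) = (2 : K) • ψ i := by
      rw [hham i hi]
      funext t
      rcases t with t | t <;> simp [ham] <;> ring
    have h3 : dir ((2 : K) • ψ i) f = (2 : K) • dir (ψ i) f := by
      simp [dir_apply, Finset.smul_sum, mul_smul]
    have h4 : mulLin (0 : Fin n ⊕ Fin n → K) f = 0 := by simp [mulLin]
    simp only [r, hfix i hi, sub_self, h1, LinearMap.sub_apply, LinearMap.smul_apply, h3, h4,
      zero_sub, smul_smul, hε]
    rw [← neg_smul]
    congr 1
    ring
  have hrn : ∀ i, ¬ b i → r i = mulLin (y i) - h • dir (ham (c i + c i ᵥ* γ.1.map ρ)) := by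
    intro i hi
    simp only [r, hmove i hi]
  have hsb : ∀ i, b i → s i = ε⁻¹ • mulLin (y i) := fun i hi => if_pos hi
  have hsn : ∀ i, ¬ b i → s i = dir (ψ i) := fun i hi => if_neg hi
  have hscalar : ∀ i j, moyal h n (lin (c i)) (lin (c j)) - moyal h n (lin (c j)) (lin (c i)) =
      (-2 * h * (ham (c j) ⬝ᵥ c i)) • (1 : Poly K n) := by
    intro i j
    rw [moyal_lin, lin_moyal, dir_lin, C_eq_smul_one, smul_smul]
    have : (-2 * h * (ham (c j) ⬝ᵥ c i)) = -(h * (ham (c j) ⬝ᵥ c i)) - h * (ham (c j) ⬝ᵥ c i) := by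
      ring
    rw [this, sub_smul, neg_smul]
    abel
  have hgen : ∀ S : Submodule K (Poly K n), 1 ∈ S →
      (∀ i, ∀ f ∈ S, moyal h n f (lin (c i)) ∈ S) → ∀ f, f ∈ S := by
    intro S h1 hS
    refine mem_of_moyal_lin_mem h S h1 (fun x f hf => ?_)
    have : moyal h n f (lin x) = ∑ i, (φ i ⬝ᵥ x) • moyal h n f (lin (c i)) := by
      conv_lhs => rw [← hc x]
      rw [map_sum]
      have := map_sum (AddMonoidHom.mk' (moyal h n f) (moyal_add n h f))
        (fun i => lin ((φ i ⬝ᵥ x) • c i)) Finset.univ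
      refine this.trans (Finset.sum_congr rfl fun i _ => ?_)
      rw [map_smul]
      exact moyal_smul n h _ _ _
    rw [this]
    exact S.sum_mem fun i _ => S.smul_mem _ (hS i f hf)
  have hδ : ∀ i j (f : Poly K n), dir (φ i) (moyal h n f (lin (c j))) =
      moyal h n (dir (φ i) f) (lin (c j)) + if i = j then f else 0 := by
    intro i j f
    rw [moyal_lin, moyal_lin, map_sub, map_smul, dir_dir, dir_lin_mul, hφc]
    by_cases hij : i = j
    · simp only [hij, if_true, one_smul]
      exact (sub_add_eq_add_sub _ _ _).symm
    · simp only [hij, if_false, zero_smul, add_zero]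
  have hrs : ∀ i j (f : Poly K n), i ≤ j → s j (r i f) + (if b i ∧ i = j then f else 0) =
      r i (s j f) + if ¬ b i ∧ i = j then f else 0 := by
    intro i j f hij
    by_cases hi : b i
    · by_cases hj : b j
      · simp only [hrb i hi, hsb j hj, LinearMap.smul_apply, map_smul, smul_smul, dir_mulLin,
          hψy, hi, smul_add, not_true, true_and, false_and, if_false, add_zero,
          inv_mul_cancel₀ h2, mul_inv_cancel₀ h2, one_smul]
        by_cases hij' : i = j
        · simp [hij', h2]
        · simp [hij']
      · have hne : i ≠ j := by rintro rfl; exact hj hi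
        simp only [hrb i hi, hsn j hj, LinearMap.smul_apply, map_smul, hne, and_false, if_false,
          dir_dir (ψ j) (ψ i)]
    · have hj : ¬ b j := fun hj => (hmono i j hj hi).not_ge hij
      simp only [hrn i hi, hsn j hj, LinearMap.sub_apply, LinearMap.smul_apply, map_sub, map_smul,
        dir_mulLin, hψy, hi, false_and, if_false, add_zero, not_false_iff, true_and,
        dir_dir (ψ j) (ham _)]
      by_cases hij' : i = j
      · simp only [hij', if_true, one_smul]
        abel
      · simp [hij', Ne.symm hij']
  have huniq : ∀ f : Poly K n, (∀ i, b i → r i f = 0) → (∀ i, ¬ b i → s i f = 0) →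
      ∃ k : K, f = k • 1 := by
    intro f hf1 hf2
    have hd : ∀ i, dir (ψ i) f = 0 := by
      intro i
      by_cases hi : b i
      · have := hf1 i hi
        rw [hrb i hi] at this
        exact (smul_eq_zero.1 this).resolve_left h2
      · have := hf2 i hi
        rwa [hsn i hi] at this
    have hp : ∀ t, pderiv t f = 0 := by
      intro t
      have h1 : ∀ u, ∑ i, y i t * ψ i u = if t = u then 1 else 0 := by
        intro u
        have := congrFun (hy (Pi.single u 1)) t
        simpa [Pi.single_apply, mul_comm] using this
      have h3 : ∑ i, y i t • dir (ψ i) f = pderiv t f := by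
        simp only [dir_apply, Finset.smul_sum, smul_smul]
        rw [Finset.sum_comm]
        simp only [← Finset.sum_smul, h1, ite_smul, one_smul, zero_smul, Finset.sum_ite_eq,
          Finset.mem_univ, if_true]
      rw [← h3]
      exact Finset.sum_eq_zero fun i _ => by rw [hd i, smul_zero]
    exact ⟨coeff 0 f, (eq_C_of_pderiv_eq_zero f hp).trans C_eq_smul_one⟩
  have hcomm : ∀ i j (f : Poly K n), ¬ b i → ¬ b j → s i (s j f) = s j (s i f) := by
    intro i j f hi hj
    rw [hsn i hi, hsn j hj, dir_dir]
  have hrnil : ∀ i, b i → IsLocNil (r i) := fun i hi => by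
    rw [hrb i hi]
    exact (dir_locNil (ψ i)).smul _
  have hsnil : ∀ i, ¬ b i → IsLocNil (s i) := fun i hi => by
    rw [hsn i hi]
    exact dir_locNil (ψ i)
  have hr1 : ∀ i, b i → r i 1 = 0 := fun i hi => by
    rw [hrb i hi, LinearMap.smul_apply, dir_one, smul_zero]
  have hs1 : ∀ i, ¬ b i → s i 1 = 0 := fun i hi => by rw [hsn i hi, dir_one]
  exact Bar.twistedHomology_of_fockSpace (A := WeylAlgebra h n) (act h ρ γ)
    (fun i => (lin (c i) : Poly K n))
    (fun i j => ⟨-2 * h * (ham (c j) ⬝ᵥ c i), (hscalar i j).trans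
      (Algebra.algebraMap_eq_smul_one (A := WeylAlgebra h n) _).symm⟩) hgen
    (fun i => (dir (φ i) : Module.End K (Poly K n))) hδ (fun i => dir_locNil (φ i)) b r s
    (fun i f => (moyal_lin_sub h ρ γ (c i) f).symm) hrs hcomm hmono hrnil hsnil hr1 hs1 huniq

end

end Weyl

/-! ### Bases adapted to a linear symplectomorphism -/

/-- Let `g` be a linear map which preserves a nondegenerate bilinear form `B`. A basis of the fixed
vectors of `g` extends to a basis `c` of the whole space such that the vectors `c i - g (c i)`, for
the `i` which have been added, extend to a basis `y`, whose remaining coordinate functions are the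
forms `B (c i)` with `c i` fixed. -/
theorem exists_adapted_bases {F V : Type*} [Field F] [AddCommGroup V] [Module F V]
    [FiniteDimensional F V] (B : V →ₗ[F] V →ₗ[F] F) (hB : ∀ z, (∀ x, B x z = 0) → z = 0)
    (g : Module.End F V) (hg : ∀ x z, B (g x) (g z) = B x z) {d : ℕ}
    (hd : Module.finrank F (LinearMap.ker (LinearMap.id - g)) = d) :
    ∃ (m : ℕ) (c y : Module.Basis (Fin d ⊕ Fin m) F V),
      (∀ i, g (c (Sum.inl i)) = c (Sum.inl i)) ∧ (∀ i, B (c (Sum.inl i)) = y.coord (Sum.inl i)) ∧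
        ∀ i, c (Sum.inr i) - g (c (Sum.inr i)) = y (Sum.inr i) := by
  set E := LinearMap.ker (LinearMap.id - g)
  obtain ⟨W, hW⟩ := E.exists_isCompl
  let c : Module.Basis (Fin d ⊕ Fin (Module.finrank F W)) F V :=
    ((Module.finBasisOfFinrankEq F E hd).prod (Module.finBasis F W)).map
      (Submodule.prodEquivOfIsCompl E W hW)
  have hcl : ∀ i, c (Sum.inl i) ∈ E := fun i => by simp [c]
  have hcr : ∀ i, c (Sum.inr i) = Module.finBasis F W i := fun i => by simp [c]
  have hfix : ∀ i, g (c (Sum.inl i)) = c (Sum.inl i) := fun i =>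
    (sub_eq_zero.1 (LinearMap.mem_ker.1 (hcl i))).symm
  have hflip : Function.Surjective B.flip := by
    refine (LinearMap.injective_iff_surjective_of_finrank_eq_finrank
      (Subspace.dual_finrank_eq (K := F) (V := V)).symm).1 ?_
    exact (injective_iff_map_eq_zero _).2 fun z hz => hB z fun x => LinearMap.congr_fun hz x
  -- `z` is dual to the fixed vectors, while `c i - g (c i)` is orthogonal to them
  choose z hz using fun i : Fin d => hflip (c.coord (Sum.inl i))
  have hz' : ∀ j i, B (c j) (z i) = if j = Sum.inl i then 1 else 0 := fun j i => by
    have := LinearMap.congr_fun (hz i) (c j)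
    simpa [Finsupp.single_apply] using this
  let w : Fin (Module.finrank F W) → V := fun i => c (Sum.inr i) - g (c (Sum.inr i))
  have hw : ∀ i x, B (c (Sum.inl i)) (x - g x) = 0 := fun i x => by
    have := hg (c (Sum.inl i)) x
    rw [hfix] at this
    rw [map_sub, this, sub_self]
  have hli : LinearIndependent F (Sum.elim z w) := by
    rw [Fintype.linearIndependent_iff]
    intro a ha
    simp only [Fintype.sum_sum_type, Sum.elim_inl, Sum.elim_inr] at ha
    have ha1 : ∀ i, a (Sum.inl i) = 0 := fun i => by
      have := congrArg (B (c (Sum.inl i))) ha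
      simpa [hz', w, hw] using this
    simp only [ha1, zero_smul, Finset.sum_const_zero, zero_add] at ha
    have ha2 : ∑ i, a (Sum.inr i) • Module.finBasis F W i = 0 := by
      have h1 : ((∑ i, a (Sum.inr i) • Module.finBasis F W i : W) : V) ∈ E := by
        rw [LinearMap.mem_ker, ← ha, Submodule.coe_sum, map_sum]
        refine Finset.sum_congr rfl fun i _ => ?_
        rw [Submodule.coe_smul, map_smul, ← hcr]
        rfl
      have h2 := Submodule.disjoint_def.1 hW.disjoint _ h1 (Subtype.coe_prop _)
      exact_mod_cast h2
    have ha3 := Fintype.linearIndependent_iff.1 (Module.finBasis F W).linearIndependent _ ha2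
    rintro (i | i)
    · exact ha1 i
    · exact ha3 i
  have hcard : Fintype.card (Fin d ⊕ Fin (Module.finrank F W)) = Module.finrank F V :=
    (Module.finrank_eq_card_basis c).symm
  let y := basisOfLinearIndependentOfCardEqFinrank' _ hli hcard
  have hy : ∀ i, y i = Sum.elim z w i := fun i => by simp [y]
  refine ⟨_, c, y, hfix, fun i => y.ext fun j => ?_, fun i => ?_⟩
  · rw [Module.Basis.coord_apply, Module.Basis.repr_self, hy]
    rcases j with j | j
    · rw [Sum.elim_inl, hz', Finsupp.single_apply]
      simp [eq_comm]
    · rw [Sum.elim_inr, hw]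
      simp
  · rw [hy]
    rfl

namespace Weyl

open Matrix

variable {n : ℕ}

theorem ham_eq_J_mulVec {K : Type} [Field K] (c : Fin n ⊕ Fin n → K) :
    ham c = J (Fin n) K *ᵥ c := by
  funext s
  rcases s with s | s <;>
    simp [ham, J, mulVec, dotProduct, Fintype.sum_sum_type, Matrix.one_apply]

theorem ham_vecMul_dotProduct (γ : symplecticGroup (Fin n) ℝ) (x z : Fin n ⊕ Fin n → ℝ) :
    ham (x ᵥ* γ.1) ⬝ᵥ (z ᵥ* γ.1) = ham x ⬝ᵥ z := by
  have h := SymplecticGroup.mem_iff.1 γ.2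
  rw [ham_eq_J_mulVec, ham_eq_J_mulVec, dotProduct_comm, ← dotProduct_mulVec,
    ← mulVec_transpose γ.1 x, mulVec_mulVec, mulVec_mulVec, h, dotProduct_comm]

theorem finrank_ker_transpose {ι : Type*} [Fintype ι] [DecidableEq ι] (M : Matrix ι ι ℝ) :
    Module.finrank ℝ (LinearMap.ker (toLin' Mᵀ)) = Module.finrank ℝ (LinearMap.ker (toLin' M)) := by
  have h1 := LinearMap.finrank_range_add_finrank_ker (toLin' M)
  have h2 := LinearMap.finrank_range_add_finrank_ker (toLin' Mᵀ)
  have h3 : Module.finrank ℝ (LinearMap.range (toLin' Mᵀ)) =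
      Module.finrank ℝ (LinearMap.range (toLin' M)) := rank_transpose M
  omega

/-- The bilinear form `(x, z) ↦ ham x ⬝ᵥ z` on linear forms, i.e. the Poisson bracket up to sign. -/
noncomputable def hamForm : (Fin n ⊕ Fin n → ℝ) →ₗ[ℝ] (Fin n ⊕ Fin n → ℝ) →ₗ[ℝ] ℝ :=
  dotProductBilin ℝ ℝ ∘ₗ toLin' (J (Fin n) ℝ)

theorem hamForm_apply (x z : Fin n ⊕ Fin n → ℝ) : hamForm x z = ham x ⬝ᵥ z := by
  rw [ham_eq_J_mulVec]
  rfl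

theorem eq_zero_of_ham_dotProduct (z : Fin n ⊕ Fin n → ℝ) (h : ∀ x, ham x ⬝ᵥ z = 0) : z = 0 := by
  funext s
  rcases s with s | s
  · have := h (Pi.single (Sum.inr s) 1)
    simpa [ham, dotProduct, Fintype.sum_sum_type, Pi.single_apply] using this
  · have := h (Pi.single (Sum.inl s) 1)
    simpa [ham, dotProduct, Fintype.sum_sum_type, Pi.single_apply] using this

variable {ι : Type*}

/-- The coordinate functions of a basis of the linear forms, as constant vector fields. -/
noncomputable def dualVec (c : Module.Basis ι ℝ (Fin n ⊕ Fin n → ℝ)) (i : ι) : Fin n ⊕ Fin n → ℝ :=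
  fun s => c.coord i (Pi.single s 1)

theorem dualVec_dotProduct (c : Module.Basis ι ℝ (Fin n ⊕ Fin n → ℝ)) (i : ι)
    (x : Fin n ⊕ Fin n → ℝ) : dualVec c i ⬝ᵥ x = c.coord i x := by
  conv_rhs => rw [pi_eq_sum_univ' x, map_sum]
  refine Finset.sum_congr rfl fun s _ => ?_
  rw [map_smul, smul_eq_mul, mul_comm]
  rfl

theorem map_dualVec_dotProduct [DecidableEq ι] {K : Type} [Field K] (ρ : ℝ →+* K)
    (c : Module.Basis ι ℝ (Fin n ⊕ Fin n → ℝ)) (i j : ι) :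
    (ρ ∘ dualVec c i) ⬝ᵥ (ρ ∘ c j) = if i = j then 1 else 0 := by
  rw [← RingHom.map_dotProduct, dualVec_dotProduct, Module.Basis.coord_apply,
    Module.Basis.repr_self, Finsupp.single_apply, apply_ite ρ, map_one, map_zero]
  simp [eq_comm]

theorem map_sum_dualVec [Fintype ι] {K : Type} [Field K] (ρ : ℝ →+* K)
    (c : Module.Basis ι ℝ (Fin n ⊕ Fin n → ℝ)) (x : Fin n ⊕ Fin n → K) :
    ∑ i, ((ρ ∘ dualVec c i) ⬝ᵥ x) • (ρ ∘ c i) = x := by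
  have h : ∀ s t, ∑ i, ρ (dualVec c i s) * ρ (c i t) = if s = t then 1 else 0 := by
    intro s t
    have := congrFun (c.sum_repr (Pi.single s 1)) t
    rw [Finset.sum_apply] at this
    simp only [← map_mul, ← map_sum]
    rw [← map_one ρ, ← map_zero ρ, ← apply_ite ρ]
    congr 1
    refine Eq.trans this ?_
    simp [Pi.single_apply, eq_comm]
  funext t
  simp only [Finset.sum_apply, Pi.smul_apply, smul_eq_mul, dotProduct, Finset.sum_mul,
    Function.comp_apply]
  rw [Finset.sum_comm]
  simp only [mul_right_comm _ (x _), ← Finset.sum_mul, h, ite_mul, one_mul, zero_mul,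
    Finset.sum_ite_eq', Finset.mem_univ, if_true]

theorem ham_map {K : Type} [Field K] (ρ : ℝ →+* K) (c : Fin n ⊕ Fin n → ℝ) :
    ham (ρ ∘ c) = ρ ∘ ham c := by
  funext s
  rcases s with s | s <;> simp [ham]

/-- The twisted homology of the Weyl algebra over any field containing the real numbers. -/
theorem twistedHomology_act {K : Type} [Field K] [CharZero K] (h : K) (hh : h ≠ 0) (ρ : ℝ →+* K)
    (γ : symplecticGroup (Fin n) ℝ) {d : ℕ} (hd : Module.finrank ℝ (fixedSpace γ) = d) :
    (∀ p, p ≠ d → Subsingleton (Hochschild.HH K (act h ρ γ) p)) ∧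
      Nonempty (Hochschild.HH K (act h ρ γ) d ≃ₗ[K] K) := by
  have hg : ∀ x, toLin' γ.1ᵀ x = x ᵥ* γ.1 := fun x => by rw [toLin'_apply, mulVec_transpose]
  have hd' : Module.finrank ℝ (LinearMap.ker (LinearMap.id - toLin' γ.1ᵀ)) = d := by
    have h1 : LinearMap.id - toLin' γ.1ᵀ = -toLin' (γ.1 - 1)ᵀ := by
      rw [transpose_sub, transpose_one, map_sub, toLin'_one, neg_sub]
    have h2 : fixedSpace γ = LinearMap.ker (toLin' (γ.1 - 1)) := by
      rw [fixedSpace, map_sub, toLin'_one]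
    rw [h1, LinearMap.ker_neg, finrank_ker_transpose, ← h2, hd]
  obtain ⟨m, c, y, h1, h2, h3⟩ := exists_adapted_bases (hamForm (n := n))
    (fun z hz => eq_zero_of_ham_dotProduct z fun x => by rw [← hamForm_apply, hz])
    (toLin' γ.1ᵀ) (fun x z => by rw [hamForm_apply, hamForm_apply, hg, hg, ham_vecMul_dotProduct])
    hd'
  have hρ : ∀ x : Fin n ⊕ Fin n → ℝ, (ρ ∘ x) ᵥ* γ.1.map ρ = ρ ∘ (x ᵥ* γ.1) := fun x =>
    (funext fun s => RingHom.map_vecMul ρ γ.1 x s).symm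
  have hsum : (∑ i : Fin (d + m), if (i : ℕ) < d then 1 else 0) = d := by
    rw [Fin.sum_univ_add]
    simp
  let c' := c.reindex finSumFinEquiv
  let y' := y.reindex finSumFinEquiv
  have hfix : ∀ i : Fin (d + m), (i : ℕ) < d → (ρ ∘ c' i) ᵥ* γ.1.map ρ = ρ ∘ c' i := by
    refine Fin.addCases (fun i _ => ?_) fun i hi => ?_
    · have := h1 i
      rw [hg] at this
      simp [c', hρ, this]
    · simp at hi
  have hham : ∀ i : Fin (d + m), (i : ℕ) < d → ρ ∘ dualVec y' i = ham (ρ ∘ c' i) := by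
    refine Fin.addCases (fun i _ => ?_) fun i hi => ?_
    · rw [ham_map]
      congr 1
      funext s
      have := LinearMap.congr_fun (h2 i) (Pi.single s 1)
      rw [hamForm_apply] at this
      simpa [c', y', dualVec] using this.symm
    · simp at hi
  have hmove : ∀ i : Fin (d + m), ¬ (i : ℕ) < d →
      ρ ∘ c' i - (ρ ∘ c' i) ᵥ* γ.1.map ρ = ρ ∘ y' i := by
    refine Fin.addCases (fun i hi => ?_) fun i _ => ?_
    · simp at hi
    · have := h3 i
      rw [hg] at this
      funext s
      simp [c', y', hρ, ← this]
  have key := twistedHomology_of_adaptedBases h hh ρ γ (fun i : Fin (d + m) => (i : ℕ) < d)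
    (fun i j hj hi => Fin.lt_def.2 (by omega)) (fun i => ρ ∘ c' i) (fun i => ρ ∘ dualVec c' i)
    (fun i => ρ ∘ y' i) (fun i => ρ ∘ dualVec y' i) (map_dualVec_dotProduct ρ c')
    (map_sum_dualVec ρ c') (map_dualVec_dotProduct ρ y') (map_sum_dualVec ρ y') hfix hham hmove
  rwa [hsum] at key

theorem hbar_ne_zero : hbar ≠ 0 := HahnSeries.single_ne_zero one_ne_zero

end Weyl

theorem proposition2p2 (n k : ℕ) (γ : Matrix.symplecticGroup (Fin n) ℝ)
    (hk : Module.finrank ℝ (Weyl.fixedSpace γ) = 2 * k) (p : ℕ) :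
    (p = 2 * k → Nonempty (Hochschild.HH Weyl.KK (Weyl.sympAut γ) p ≃ₗ[Weyl.KK] Weyl.KK)) ∧
      (p ≠ 2 * k → Subsingleton (Hochschild.HH Weyl.KK (Weyl.sympAut γ) p)) := by
  obtain ⟨h0, h1⟩ := Weyl.twistedHomology_act Weyl.hbar Weyl.hbar_ne_zero Weyl.realToKK γ hk
  exact ⟨fun hp => hp ▸ h1, h0 p⟩
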